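/- Let $P$ be a topological space homeomorphic to $\mathbb{R}^2$ with two transverse $C^0$ foliations $\mathcal{F}_1,\mathcal{F}_2$ by properly embedded, continuously oriented lines (transverse: every point has a chart onto $\mathbb{R}^2$ taking the plaques of $\mathcal{F}_1,\mathcal{F}_2$ to horizontal and vertical lines). Let $\mathrm{Aut}^+(P)$ be the group of homeomorphisms of $P$ preserving each foliation and the orientation of its leaves. Let $i\in\{1,2\}$, let $j\ne i$ be the other index, and let $\Lambda_i=P/\mathcal{F}_i$ be the leaf space with the quotient topology. It is oriented by the $\mathcal{F}_j$-leaves, and partially ordered by: $x<y$ if there is an orientation preserving embedding $\gamma:[0,1]\to\Lambda_i$ with $\gamma(0)=x$, $\gamma(1)=y$. The order on $\Lambda_j$ is defined in the same way, with the two foliations exchanged. For a leaf $s$ of either foliation, the front (resp. back) of $s$ is the connected component of $P\setminus s$ containing the leaves $s'>s$ (resp. $s'<s$) of the same foliation. Two points of $\Lambda_i$ are non-separated if every neighbourhood of one meets every neighbourhood of the other; a cataclysm is a maximal set of pairwise non-separated points. For distinct non-separated leaves $l_1,l_2$ of $\mathcal{F}_i$, say $l_1<l_2$ (resp. $l_1>l_2$)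 if $s_1$ lies in the back (resp. front) of $s_2$, where $s_1,s_2$ are leaves of $\mathcal{F}_j$ with $s_1\cap l_1\neq\emptyset$ and $s_2\cap l_2\ne\emptyset$. Then: (a) such $s_1,s_2$ exist and the relations $l_1<l_2$ and $l_1>l_2$ do not depend on their choice, and $l_1>l_2$ if and only if $l_2<l_1$; (b) on every cataclysm of $\Lambda_i$ the relation $<$ is transitive and is a strict linear order; (c) it is invariant: $g l_1<g l_2$ if and only if $l_1<l_2$, for all $g\in\mathrm{Aut}^+(P)$. In particular $\Lambda_i$ has orderable cataclysms with respect to $\mathrm{Aut}^+(P)$, and also with respect to every subgroup $G\subseteq\mathrm{Aut}^+(P)$; that is, there is a choice of a linear order on each cataclysm such that every group element $g$ carries the order on each cataclysm $\mu$ to the order on $g\mu$. -/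

import Mathlib

open Set Topology

/-- Two points of a topological space are non-separated if every neighbourhood of one meets every
neighbourhood of the other. -/
def NonSeparated {X : Type*} [TopologicalSpace X] (x y : X) : Prop :=
  ∀ U ∈ 𝓝 x, ∀ V ∈ 𝓝 y, (U ∩ V).Nonempty

/-- A cataclysm is a maximal set of pairwise non-separated points. -/
def IsCataclysm {X : Type*} [TopologicalSpace X] (μ : Set X) : Prop :=
  Maximal (fun S : Set X => S.Pairwise NonSeparated) μ

/-- `X` has orderable cataclysms with respect to an action of `G` by homeomorphisms: one can choose
a strict linear order `r μ` on every cataclysm `μ` so that each `g : G` carries the order chosen on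
`μ` to the order chosen on `g μ`. -/
def HasOrderableCataclysms (G X : Type*) [Group G] [TopologicalSpace X] [MulAction G X]
    [ContinuousConstSMul G X] : Prop :=
  ∃ r : Set X → X → X → Prop,
    (∀ μ, IsCataclysm μ → IsStrictTotalOrder μ (fun x y : μ => r μ x y)) ∧
    ∀ (g : G) (μ : Set X), IsCataclysm μ → ∀ x ∈ μ, ∀ y ∈ μ,
      (r ((fun z => g • z) '' μ) (g • x) (g • y) ↔ r μ x y)

/-- A partition of a space `P` into oriented, properly embedded lines. The lines are the classes of
`rel`, and `ahead p q` says that `p` and `q` lie on the same line and that `q` comes strictly after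
`p` for its orientation. (For Hausdorff locally compact `P`, a proper embedding of `ℝ` is the same
thing as a closed embedding.) -/
structure OrientedLines (P : Type*) [TopologicalSpace P] where
  rel : Setoid P
  ahead : P → P → Prop
  rel_of_ahead : ∀ p q, ahead p q → rel p q
  exists_param : ∀ p, ∃ c : ℝ → P, IsClosedEmbedding c ∧ range c = {q | rel q p} ∧
    ∀ s t, ahead (c s) (c t) ↔ s < t

/-- The index of the other foliation. -/
def otherIdx (i : Fin 2) : Fin 2 := 1 - i

/-- A bifoliated plane with oriented foliations: a topological plane with two `C⁰` foliations
(indexed by `Fin 2`) by oriented, properly embedded lines that are transverse, i.e. every point has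
an open neighbourhood with a homeomorphism onto `ℝ²` taking the plaques of the foliation `i`
(the components of the traces of its leaves) to the lines parallel to the `i`-th axis. The
orientations of the leaves are continuous: such a chart can be chosen so that the leaves of the
foliation `i` are oriented in it by increasing `i`-th coordinate. -/
structure BifoliatedPlane (P : Type*) [TopologicalSpace P] where
  isPlane : Nonempty (P ≃ₜ (Fin 2 → ℝ))
  fol : Fin 2 → OrientedLines P
  exists_chart : ∀ p, ∃ φ : OpenPartialHomeomorph P (Fin 2 → ℝ),
    p ∈ φ.source ∧ φ.target = univ ∧
    ∀ i, ∀ a ∈ φ.source, ∀ b ∈ φ.source,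
      (b ∈ connectedComponentIn (φ.source ∩ {q | (fol i).rel q a}) a ↔
        φ b (otherIdx i) = φ a (otherIdx i)) ∧
      (φ b (otherIdx i) = φ a (otherIdx i) → ((fol i).ahead a b ↔ φ a i < φ b i))

namespace BifoliatedPlane

variable {P : Type*} [TopologicalSpace P] (B : BifoliatedPlane P)

/-- The leaf space of the `i`-th foliation, with the quotient topology. -/
def LeafSpace (i : Fin 2) : Type _ := Quotient (B.fol i).rel

instance (i : Fin 2) : TopologicalSpace (B.LeafSpace i) :=
  inferInstanceAs (TopologicalSpace (Quotient (B.fol i).rel))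

/-- The projection of the plane to the leaf space. -/
def proj (i : Fin 2) (p : P) : B.LeafSpace i := Quotient.mk (B.fol i).rel p

/-- A point of the leaf space, seen as a leaf in the plane. -/
def leaf {i : Fin 2} (l : B.LeafSpace i) : Set P := {p | B.proj i p = l}

/-- The group of homeomorphisms of the plane that preserve both foliations and the orientations of
their leaves. -/
def autPos : Subgroup (P ≃ₜ P) where
  carrier := {g | ∀ i p q, ((B.fol i).rel (g p) (g q) ↔ (B.fol i).rel p q) ∧
    ((B.fol i).ahead (g p) (g q) ↔ (B.fol i).ahead p q)}
  mul_mem' := by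
    intro g h hg hh i p q
    exact ⟨(hg i (h p) (h q)).1.trans (hh i p q).1, (hg i (h p) (h q)).2.trans (hh i p q).2⟩
  one_mem' := fun _ _ _ => ⟨Iff.rfl, Iff.rfl⟩
  inv_mem' := by
    intro g hg i p q
    have h := hg i (g⁻¹ p) (g⁻¹ q)
    have e : ∀ x, g (g⁻¹ x) = x := fun x => g.apply_symm_apply x
    rw [e, e] at h
    exact ⟨h.1.symm, h.2.symm⟩

/-- The induced action on the leaf spaces: the leaf of `p` is sent to the leaf of `g p`. -/
instance (i : Fin 2) : MulAction B.autPos (B.LeafSpace i) where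
  smul g := Quotient.map (fun p => g.1 p) (fun p q h => (g.2 i p q).1.2 h)
  one_smul := by rintro ⟨p⟩; rfl
  mul_smul := by rintro g h ⟨p⟩; rfl

theorem smul_proj (i : Fin 2) (g : B.autPos) (p : P) :
    g • B.proj i p = B.proj i (g.1 p) := rfl

instance (i : Fin 2) : ContinuousConstSMul B.autPos (B.LeafSpace i) where
  continuous_const_smul g :=
    g.1.continuous.quotient_map' (fun p q h => (g.2 i p q).1.2 h)

instance (i : Fin 2) (G : Subgroup B.autPos) : ContinuousConstSMul G (B.LeafSpace i) where
  continuous_const_smul g := continuous_const_smul (g : B.autPos)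

/-- A path in the `i`-th leaf space preserves orientation, for the orientation of the leaf space
induced by that of the other foliation, if locally it lifts to a path that moves in the positive
direction along a leaf of the other foliation. -/
def OrientationPreserving {i : Fin 2} (γ : unitInterval → B.LeafSpace i) : Prop :=
  ∀ t, ∃ U ∈ 𝓝 t, ∃ c : unitInterval → P, ContinuousOn c U ∧
    (∀ s ∈ U, B.proj i (c s) = γ s) ∧
    ∀ s ∈ U, ∀ s' ∈ U, s < s' → (B.fol (otherIdx i)).ahead (c s) (c s')

/-- The partial order on a leaf space: `x < y` if an orientation preserving embedded interval goes
from `x` to `y`. -/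
def LeafLT {i : Fin 2} (x y : B.LeafSpace i) : Prop :=
  ∃ γ : unitInterval → B.LeafSpace i,
    IsEmbedding γ ∧ B.OrientationPreserving γ ∧ γ 0 = x ∧ γ 1 = y

/-- The front of a leaf `l`: the component of the complement of `l` that contains the leaves
`l' > l`. -/
def front {i : Fin 2} (l : B.LeafSpace i) : Set P :=
  {p | ∃ l', B.LeafLT l l' ∧ ∃ q ∈ B.leaf l', p ∈ connectedComponentIn (B.leaf l)ᶜ q}

/-- The back of a leaf `l`: the component of the complement of `l` that contains the leaves
`l' < l`. -/
def back {i : Fin 2} (l : B.LeafSpace i) : Set P :=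
  {p | ∃ l', B.LeafLT l' l ∧ ∃ q ∈ B.leaf l', p ∈ connectedComponentIn (B.leaf l)ᶜ q}

/-- A leaf of one foliation crosses a leaf of the other. -/
def Crosses {i : Fin 2} (s : B.LeafSpace (otherIdx i)) (l : B.LeafSpace i) : Prop :=
  (B.leaf s ∩ B.leaf l).Nonempty

/-- The order on distinct non-separated leaves: `l₁ < l₂` if some transverse leaf `s₁` crossing `l₁`
lies in the back of some transverse leaf `s₂` crossing `l₂`. -/
def CataclysmLT {i : Fin 2} (l₁ l₂ : B.LeafSpace i) : Prop :=
  l₁ ≠ l₂ ∧ NonSeparated l₁ l₂ ∧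
    ∃ s₁ s₂ : B.LeafSpace (otherIdx i), B.Crosses s₁ l₁ ∧ B.Crosses s₂ l₂ ∧
      B.leaf s₁ ⊆ B.back s₂

end BifoliatedPlane

/-! The core is a Jordan-type statement: a leaf `l` cuts the plane into exactly two connected sides,
and every transverse leaf meeting `l` crosses it once, from the back to the front. Charts give `l` a
two-sided collar (`exists_coherent_boxes`). A circle-valued function that goes once around the
circle across the collar lifts to `ℝ`, because the plane is simply connected, and a level of the
lift separates (`exists_separation_of_two_sided`). The sides are connected because each has a
connected trace near every point of `l` (`isPreconnected_of_collar`), and they are the front and the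
back (`isSides_front_back`).

Let `l₁ ≠ l₂` be non-separated. A transverse leaf embeds as an open line in the leaf space, so it
cannot cross both (`Crosses.not_crosses`). Hence `s₁` and `s₂` are disjoint, and `s₁` lies on the
same side of `s₂` as the connected set `l₁`. By non-separation some leaf `l` crosses both `s₁` and
`s₂`. The order of the two crossings along `l` shows that `s₁` is in the back of `s₂` iff `s₂` is in
the front of `s₁` (`leaf_subset_back_iff_subset_front`). This duality gives independence of the
choices and antisymmetry. Totality holds since `s₁` is on one side of `s₂`, and transitivity since
backs are nested (`back_subset_back`). Invariance is formal: automorphisms preserve all the data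
used. -/

open Filter

/-! ### Separation in a simply connected space -/

/-- A closed connected set with a two-sided neighbourhood separates a simply connected space. -/
theorem exists_separation_of_two_sided {X : Type*} [TopologicalSpace X] [SimplyConnectedSpace X]
    [LocallyPathConnectedSpace X] [TopologicalSpace.MetrizableSpace X] {L N₁ N₂ : Set X}
    (hL : IsClosed L) (hLc : IsPreconnected L) (hLn : L.Nonempty) (h₁ : IsOpen N₁) (h₂ : IsOpen N₂)
    (h₁₂ : Disjoint N₁ N₂) (hL₁ : Disjoint L N₁) (hL₂ : Disjoint L N₂)
    (hN : IsOpen (N₁ ∪ L ∪ N₂)) :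
    ∃ F B : Set X, IsOpen F ∧ IsOpen B ∧ Disjoint F B ∧ F ∪ B = Lᶜ ∧
      ∀ q ∈ L, ∃ W ∈ 𝓝 q, W ∩ N₁ ⊆ F ∧ W ∩ N₂ ⊆ B := by
  let := TopologicalSpace.metrizableSpaceMetric X
  obtain ⟨g, hg0, hg1, hg⟩ := exists_continuous_zero_one_of_isClosed hL hN.isClosed_compl
    (disjoint_left.2 fun x hx hx' => hx' (Or.inl (Or.inr hx)))
  -- The Urysohn function `g` may vanish off `L`; taking the maximum with the truncated distance
  -- makes `L` the exact zero set.
  obtain ⟨h, hc, h0, h1, hb⟩ : ∃ h : X → ℝ, Continuous h ∧ (∀ x, h x = 0 ↔ x ∈ L) ∧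
      (∀ x ∉ N₁ ∪ L ∪ N₂, h x = 1) ∧ ∀ x, 0 ≤ h x ∧ h x ≤ 1 := by
    refine ⟨fun x => max (g x) (min 1 (Metric.infDist x L)), ?_, ?_, ?_, ?_⟩
    · have := Metric.continuous_infDist_pt L
      fun_prop
    · intro x
      constructor
      · intro hx
        rw [hL.mem_iff_infDist_zero hLn]
        have h1 : min 1 (Metric.infDist x L) ≤ 0 := hx ▸ le_max_right _ _
        have h2 : 0 ≤ Metric.infDist x L := Metric.infDist_nonneg
        rcases min_le_iff.1 h1 with h | h <;> linarith
      · intro hx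
        have h2 := (hL.mem_iff_infDist_zero hLn).1 hx
        have h3 : g x = 0 := hg0 hx
        simp [h2, h3]
    · intro x hx
      have h3 : g x = 1 := hg1 hx
      simp [h3]
    · intro x
      exact ⟨le_max_of_le_left (hg x).1, max_le (hg x).2 (min_le_left _ _)⟩
  have key : ∀ x, x ∈ N₁ → x ∉ N₂ := fun x hx => disjoint_left.1 h₁₂ hx
  -- The two formulas agree on `L`, where `h = 0`, and outside the collar, where `h = 1` and the
  -- values `1` and `0` coincide in the circle. So they glue over the closed cover by `N₂ᶜ` and
  -- `N₁ᶜ`.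
  obtain ⟨w, hw1, hw2⟩ : ∃ w : C(X, AddCircle (1 : ℝ)),
      (∀ x ∉ N₂, w x = ((1 / 2 + h x / 2 : ℝ) : AddCircle (1 : ℝ))) ∧
      ∀ x ∉ N₁, w x = ((1 / 2 - h x / 2 : ℝ) : AddCircle (1 : ℝ)) := by
    classical
    let w : X → AddCircle (1 : ℝ) := fun x => if x ∈ N₂ then
      ((1 / 2 - h x / 2 : ℝ) : AddCircle (1 : ℝ)) else ((1 / 2 + h x / 2 : ℝ) : AddCircle (1 : ℝ))
    have e1 : ∀ x ∉ N₂, w x = ((1 / 2 + h x / 2 : ℝ) : AddCircle (1 : ℝ)) := fun x hx => if_neg hx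
    have e2 : ∀ x ∉ N₁, w x = ((1 / 2 - h x / 2 : ℝ) : AddCircle (1 : ℝ)) := by
      intro x hx
      by_cases hx2 : x ∈ N₂
      · exact if_pos hx2
      · rw [e1 x hx2]
        by_cases hxL : x ∈ L
        · simp [(h0 x).2 hxL]
        · rw [h1 x (by simp [hx, hx2, hxL])]
          norm_num
    have hcov : N₂ᶜ ∪ N₁ᶜ = univ := by
      ext x; simp only [mem_union, mem_compl_iff, mem_univ, iff_true]
      have := key x; tauto
    refine ⟨⟨w, ?_⟩, e1, e2⟩
    rw [← continuousOn_univ, ← hcov]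
    refine ContinuousOn.union_of_isClosed ?_ ?_ h₂.isClosed_compl h₁.isClosed_compl
    · refine ContinuousOn.congr (f := fun x => ((1 / 2 + h x / 2 : ℝ) : AddCircle (1 : ℝ))) ?_ e1
      exact ((AddCircle.continuous_mk' 1).comp (by fun_prop)).continuousOn
    · refine ContinuousOn.congr (f := fun x => ((1 / 2 - h x / 2 : ℝ) : AddCircle (1 : ℝ))) ?_ e2
      exact ((AddCircle.continuous_mk' 1).comp (by fun_prop)).continuousOn
  obtain ⟨a, ha⟩ := hLn
  have haN₂ : ∀ x ∈ L, x ∉ N₂ := fun x hx => disjoint_left.1 hL₂ hx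
  have haN₁ : ∀ x ∈ L, x ∉ N₁ := fun x hx => disjoint_left.1 hL₁ hx
  have hwa : ((1 / 2 : ℝ) : AddCircle (1 : ℝ)) = w a := by
    rw [hw1 a (haN₂ a ha), (h0 a).2 ha]; simp
  obtain ⟨u, ⟨hua, hu⟩, -⟩ :=
    (AddCircle.isCoveringMap_coe (1 : ℝ)).existsUnique_continuousMap_lifts w a (1 / 2) hwa
  have hu' : ∀ x, ((u x : ℝ) : AddCircle (1 : ℝ)) = w x := fun x => congrFun hu x
  have eqint : ∀ s t : ℝ, (s : AddCircle (1 : ℝ)) = t → ∃ n : ℤ, t = s + n := by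
    intro s t hst
    have : ((t - s : ℝ) : AddCircle (1 : ℝ)) = 0 := by rw [AddCircle.coe_sub, hst, sub_self]
    obtain ⟨n, hn⟩ := (AddCircle.coe_eq_zero_iff 1).1 this
    refine ⟨n, ?_⟩
    simp at hn
    linarith
  have half : ∀ n : ℤ, -1 < (n : ℝ) → (n : ℝ) < 1 → n = 0 := by
    intro n hn hn'
    have h1 : (-1 : ℤ) < n := by exact_mod_cast hn
    have h2 : n < (1 : ℤ) := by exact_mod_cast hn'
    omega
  -- Off `L` one has `0 < h x / 2 ≤ 1 / 2`, which is not an integer.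
  have uL : ∀ x, u x = 1 / 2 → x ∈ L := by
    intro x hx
    by_contra hxL
    have hpos : 0 < h x := lt_of_le_of_ne (hb x).1 fun h => hxL ((h0 x).1 h.symm)
    have hle := (hb x).2
    by_cases hx2 : x ∈ N₂
    · obtain ⟨n, hn⟩ := eqint _ _ ((hu' x).trans (hw2 x fun h => key x h hx2))
      have := half n (by linarith) (by linarith)
      subst this; simp at hn; linarith
    · obtain ⟨n, hn⟩ := eqint _ _ ((hu' x).trans (hw1 x hx2))
      have := half n (by linarith) (by linarith)
      subst this; simp at hn; linarith
  -- On `L` the lift takes values in `1 / 2 + ℤ`; two different values would force, on the connected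
  -- set `L`, an intermediate value in `ℤ`.
  have uL' : ∀ x ∈ L, u x = 1 / 2 := by
    have hint : ∀ x ∈ L, ∃ n : ℤ, u x = 1 / 2 + n := by
      intro x hx
      refine eqint _ _ ?_
      rw [hu', hw1 x (haN₂ x hx), (h0 x).2 hx]; simp
    have hconst : ∀ x ∈ L, ∀ y ∈ L, u x < u y → False := by
      intro x hx y hy hxy
      obtain ⟨n, hn⟩ := hint x hx
      obtain ⟨m, hm⟩ := hint y hy
      have hnm : (n : ℝ) < m := by linarith
      have hnm' : (n : ℝ) + 1 ≤ m := by exact_mod_cast (Int.add_one_le_iff.2 (by exact_mod_cast hnm))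
      obtain ⟨z, hz, hzu⟩ := hLc.intermediate_value hx hy u.continuous.continuousOn
        (show u x + 1 / 2 ∈ Icc (u x) (u y) from ⟨by linarith, by linarith⟩)
      obtain ⟨k, hk⟩ := hint z hz
      have : (2 * k : ℝ) = 2 * n + 1 := by linarith
      have : 2 * k = 2 * n + 1 := by exact_mod_cast this
      omega
    intro x hx
    rcases lt_trichotomy (u x) (u a) with h | h | h
    · exact (hconst x hx a ha h).elim
    · rw [h, hua]
    · exact (hconst a ha x hx h).elim
  refine ⟨{x | 1 / 2 < u x}, {x | u x < 1 / 2}, isOpen_lt continuous_const u.continuous,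
    isOpen_lt u.continuous continuous_const, ?_, ?_, ?_⟩
  · exact disjoint_left.2 fun x hx hx' => lt_asymm (show 1 / 2 < u x from hx) hx'
  · ext x
    simp only [mem_union, mem_ofPred_eq, mem_compl_iff]
    constructor
    · rintro (h | h) hx <;> rw [uL' x hx] at h <;> exact lt_irrefl _ h
    · intro hx
      rcases lt_trichotomy (1 / 2) (u x) with h | h | h
      · exact Or.inl h
      · exact (hx (uL x h.symm)).elim
      · exact Or.inr h
  · intro q hq
    -- Where `0 < u < 1` the integer ambiguity of the lift disappears, so `u` is `1 / 2 ± h / 2`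
    -- itself.
    refine ⟨{x | 0 < u x} ∩ {x | u x < 1}, ?_, ?_, ?_⟩
    · refine IsOpen.mem_nhds ((isOpen_lt continuous_const u.continuous).inter
        (isOpen_lt u.continuous continuous_const)) ?_
      simp only [mem_inter_iff, mem_ofPred_eq, uL' q hq]
      norm_num
    · rintro x ⟨⟨hx0, hx1⟩, hx⟩
      simp only [mem_ofPred_eq] at hx0 hx1 ⊢
      have hpos : 0 < h x := lt_of_le_of_ne (hb x).1 fun h => haN₁ x ((h0 x).1 h.symm) hx
      have hle := (hb x).2
      obtain ⟨n, hn⟩ := eqint _ _ ((hu' x).trans (hw1 x (key x hx)))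
      have := half n (by linarith) (by linarith)
      subst this; simp at hn; linarith
    · rintro x ⟨⟨hx0, hx1⟩, hx⟩
      simp only [mem_ofPred_eq] at hx0 hx1 ⊢
      have hpos : 0 < h x := lt_of_le_of_ne (hb x).1 fun h => haN₂ x ((h0 x).1 h.symm) hx
      have hle := (hb x).2
      obtain ⟨n, hn⟩ := eqint _ _ ((hu' x).trans (hw2 x fun h => key x h hx))
      have := half n (by linarith) (by linarith)
      subst this; simp at hn; linarith

/-! ### Leaves and foliated charts -/

theorem otherIdx_ne (i : Fin 2) : otherIdx i ≠ i := by fin_cases i <;> decide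

theorem otherIdx_otherIdx (i : Fin 2) : otherIdx (otherIdx i) = i := by fin_cases i <;> rfl

namespace BifoliatedPlane

variable {P : Type*} [TopologicalSpace P]

theorem metrizableSpace (B : BifoliatedPlane P) : TopologicalSpace.MetrizableSpace P := by
  obtain ⟨e⟩ := B.isPlane
  exact e.isEmbedding.metrizableSpace

theorem contractibleSpace (B : BifoliatedPlane P) : ContractibleSpace P := by
  obtain ⟨e⟩ := B.isPlane
  exact e.contractibleSpace

theorem locallyPathConnectedSpace (B : BifoliatedPlane P) : LocallyPathConnectedSpace P := by
  obtain ⟨e⟩ := B.isPlane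
  exact e.isOpenEmbedding.locallyPathConnectedSpace

variable {B : BifoliatedPlane P}

theorem mem_leaf_proj {i : Fin 2} {p q : P} : p ∈ B.leaf (B.proj i q) ↔ (B.fol i).rel p q :=
  Quotient.eq (r := (B.fol i).rel)

theorem mem_leaf_proj_self (i : Fin 2) (p : P) : p ∈ B.leaf (B.proj i p) := rfl

theorem proj_eq_of_mem {i : Fin 2} {l : B.LeafSpace i} {p : P} (h : p ∈ B.leaf l) :
    B.proj i p = l := h

theorem mem_leaf_iff_rel {i : Fin 2} {l : B.LeafSpace i} {p q : P} (h : q ∈ B.leaf l) :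
    p ∈ B.leaf l ↔ (B.fol i).rel p q := by
  obtain rfl := proj_eq_of_mem h
  exact mem_leaf_proj

theorem exists_param_leaf {i : Fin 2} (l : B.LeafSpace i) : ∃ c : ℝ → P, IsClosedEmbedding c ∧
    range c = B.leaf l ∧ ∀ s t, (B.fol i).ahead (c s) (c t) ↔ s < t := by
  obtain ⟨p, rfl⟩ := Quotient.exists_rep l
  obtain ⟨c, hc, hr, ha⟩ := (B.fol i).exists_param p
  refine ⟨c, hc, ?_, ha⟩
  rw [hr]
  ext q
  exact mem_leaf_proj.symm

theorem isClosed_leaf {i : Fin 2} (l : B.LeafSpace i) : IsClosed (B.leaf l) := by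
  obtain ⟨c, hc, hr, -⟩ := exists_param_leaf l
  exact hr ▸ hc.isClosed_range

theorem isPreconnected_leaf {i : Fin 2} (l : B.LeafSpace i) : IsPreconnected (B.leaf l) := by
  obtain ⟨c, hc, hr, -⟩ := exists_param_leaf l
  exact hr ▸ isPreconnected_range hc.continuous

theorem leaf_nonempty {i : Fin 2} (l : B.LeafSpace i) : (B.leaf l).Nonempty := by
  obtain ⟨c, hc, hr, -⟩ := exists_param_leaf l
  exact hr ▸ range_nonempty c

theorem leaf_eq_or_disjoint {i : Fin 2} (l m : B.LeafSpace i) :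
    l = m ∨ Disjoint (B.leaf l) (B.leaf m) := by
  by_cases h : Disjoint (B.leaf l) (B.leaf m)
  · exact Or.inr h
  · obtain ⟨x, hx, hx'⟩ := not_disjoint_iff.1 h
    exact Or.inl (hx.symm.trans hx')

theorem ahead_trichotomy {i : Fin 2} {p q : P} (h : (B.fol i).rel p q) :
    (B.fol i).ahead p q ∨ p = q ∨ (B.fol i).ahead q p := by
  obtain ⟨c, hc, hr, ha⟩ := exists_param_leaf (B.proj i q)
  obtain ⟨s, rfl⟩ : p ∈ range c := hr ▸ mem_leaf_proj.2 h
  obtain ⟨t, rfl⟩ : q ∈ range c := hr ▸ mem_leaf_proj_self i q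
  rw [ha, ha, hc.injective.eq_iff]
  exact lt_trichotomy s t

/-- These nearby points serve as witnesses to recognise which side of a transverse leaf is which. -/
theorem frequently_ahead (i : Fin 2) (p : P) : (∃ᶠ x in 𝓝 p, (B.fol i).ahead p x) ∧
    ∃ᶠ x in 𝓝 p, (B.fol i).ahead x p := by
  obtain ⟨c, hc, hr, ha⟩ := exists_param_leaf (B.proj i p)
  obtain ⟨s, rfl⟩ : p ∈ range c := hr ▸ mem_leaf_proj_self i p
  constructor
  · refine (hc.continuous.tendsto s).frequently ?_
    simp only [ha]
    exact frequently_gt_nhds s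
  · refine (hc.continuous.tendsto s).frequently ?_
    simp only [ha]
    exact frequently_lt_nhds s

/-- A chart onto the plane in which both foliations are by lines parallel to the axes, oriented by
the coordinates. -/
def IsFoliatedChart (B : BifoliatedPlane P) (φ : OpenPartialHomeomorph P (Fin 2 → ℝ)) : Prop :=
  φ.target = univ ∧ ∀ i, ∀ a ∈ φ.source, ∀ b ∈ φ.source,
      (b ∈ connectedComponentIn (φ.source ∩ {q | (B.fol i).rel q a}) a ↔
        φ b (otherIdx i) = φ a (otherIdx i)) ∧
      (φ b (otherIdx i) = φ a (otherIdx i) → ((B.fol i).ahead a b ↔ φ a i < φ b i))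

theorem exists_isFoliatedChart (p : P) : ∃ φ, B.IsFoliatedChart φ ∧ p ∈ φ.source := by
  obtain ⟨φ, hp, ht, h⟩ := B.exists_chart p
  exact ⟨φ, ⟨ht, h⟩, hp⟩

namespace IsFoliatedChart

variable {φ : OpenPartialHomeomorph P (Fin 2 → ℝ)} (hφ : B.IsFoliatedChart φ)
include hφ

theorem symm_mem (y : Fin 2 → ℝ) : φ.symm y ∈ φ.source := φ.map_target (hφ.1 ▸ mem_univ y)

theorem apply_symm (y : Fin 2 → ℝ) : φ (φ.symm y) = y := φ.right_inv (hφ.1 ▸ mem_univ y)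

theorem continuous_symm : Continuous φ.symm := by
  rw [← continuousOn_univ, ← hφ.1]
  exact φ.continuousOn_symm

theorem rel_of_coord_eq {i : Fin 2} {a b : P} (ha : a ∈ φ.source) (hb : b ∈ φ.source)
    (h : φ b (otherIdx i) = φ a (otherIdx i)) : (B.fol i).rel b a :=
  (connectedComponentIn_subset _ _ (((hφ.2 i a ha b hb).1).2 h)).2

theorem coord_eq_of_isPreconnected {i : Fin 2} {a b : P} {S : Set P} (hS : IsPreconnected S)
    (ha : a ∈ S) (hb : b ∈ S) (hSφ : S ⊆ φ.source) (hSl : ∀ x ∈ S, (B.fol i).rel x a) :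
    φ b (otherIdx i) = φ a (otherIdx i) :=
  ((hφ.2 i a (hSφ ha) b (hSφ hb)).1).1
    (hS.subset_connectedComponentIn ha
      (show S ⊆ φ.source ∩ {q | (B.fol i).rel q a} from fun x hx => ⟨hSφ hx, hSl x hx⟩) hb)

theorem ahead_iff {i : Fin 2} {a b : P} (ha : a ∈ φ.source) (hb : b ∈ φ.source)
    (h : φ b (otherIdx i) = φ a (otherIdx i)) : (B.fol i).ahead a b ↔ φ a i < φ b i :=
  (hφ.2 i a ha b hb).2 h

/-- Near a point, its leaf is a single plaque. -/
theorem eventually_coord_eq (i : Fin 2) {p : P} (hp : p ∈ φ.source) :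
    ∀ᶠ x in 𝓝 p, (B.fol i).rel x p → φ x (otherIdx i) = φ p (otherIdx i) := by
  obtain ⟨c, hc, hr, -⟩ := exists_param_leaf (B.proj i p)
  obtain ⟨s, rfl⟩ : p ∈ range c := hr ▸ mem_leaf_proj_self i p
  have h1 : c ⁻¹' φ.source ∈ 𝓝 s := hc.continuous.continuousAt (φ.open_source.mem_nhds hp)
  obtain ⟨ε, hε, hball⟩ := Metric.mem_nhds_iff.1 h1
  -- Proper embedding enters here: a point of the leaf close to `c s` has a parameter close to `s`,
  -- so the leaf does not return near `c s` along another plaque.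
  have h2 : Metric.ball s ε ∈ comap c (𝓝 (c s)) := by
    rw [← hc.isInducing.nhds_eq_comap]
    exact Metric.ball_mem_nhds s hε
  obtain ⟨O, hO, hOc⟩ := h2
  filter_upwards [hO] with x hx hrel
  obtain ⟨t, rfl⟩ : x ∈ range c := hr ▸ mem_leaf_proj.2 hrel
  refine hφ.coord_eq_of_isPreconnected (S := c '' Metric.ball s ε)
    ((convex_ball s ε).isPreconnected.image c hc.continuous.continuousOn)
    ⟨s, Metric.mem_ball_self hε, rfl⟩ ⟨t, hOc hx, rfl⟩ (image_subset_iff.2 hball) ?_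
  rintro _ ⟨r, -, rfl⟩
  exact mem_leaf_proj.1 (hr ▸ mem_range_self r)

end IsFoliatedChart

/-! ### Boxes cut by a leaf -/

/-- A neighbourhood of a point of the leaf `l` that `l` cuts into two connected sides, the
transverse leaves passing from the side `V₂` to the side `V₁`. -/
structure IsSidedBox {i : Fin 2} (l : B.LeafSpace i) (V V₁ V₂ : Set P) : Prop where
  isOpen : IsOpen V
  isOpen₁ : IsOpen V₁
  isOpen₂ : IsOpen V₂
  isPreconnected₁ : IsPreconnected V₁
  isPreconnected₂ : IsPreconnected V₂
  disjoint₁ : Disjoint V₁ (B.leaf l)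
  disjoint₂ : Disjoint V₂ (B.leaf l)
  disjoint : Disjoint V₁ V₂
  subset₁ : V₁ ⊆ V
  subset₂ : V₂ ⊆ V
  mem_or : ∀ x ∈ V, x ∈ V₁ ∨ x ∈ B.leaf l ∨ x ∈ V₂
  eventually : ∀ p ∈ V ∩ B.leaf l, ∀ᶠ x in 𝓝 p, ((B.fol (otherIdx i)).ahead p x → x ∈ V₁) ∧
    ((B.fol (otherIdx i)).ahead x p → x ∈ V₂)

/-- The box is the chart preimage of a ball so small that `l` meets it in one plaque; the two
half-balls are convex, hence connected. -/
theorem exists_isSidedBox {i : Fin 2} {l : B.LeafSpace i} {q : P} (hq : q ∈ B.leaf l) {O : Set P}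
    (hO : O ∈ 𝓝 q) : ∃ V V₁ V₂, IsSidedBox l V V₁ V₂ ∧ q ∈ V ∧ V ⊆ O := by
  obtain ⟨φ, hφ, hqφ⟩ := exists_isFoliatedChart (B := B) q
  have hev : ∀ᶠ x in 𝓝 q, x ∈ O ∧ x ∈ φ.source ∧
      ((B.fol i).rel x q → φ x (otherIdx i) = φ q (otherIdx i)) := by
    filter_upwards [hO, φ.open_source.mem_nhds hqφ, hφ.eventually_coord_eq i hqφ] with x h1 h2 h3
    exact ⟨h1, h2, h3⟩
  have hev' : ∀ᶠ y in 𝓝 (φ q), φ.symm y ∈ O ∧ ((B.fol i).rel (φ.symm y) q →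
      y (otherIdx i) = φ q (otherIdx i)) := by
    have : Tendsto φ.symm (𝓝 (φ q)) (𝓝 q) := by
      have := hφ.continuous_symm.tendsto (φ q)
      rwa [φ.left_inv hqφ] at this
    filter_upwards [this.eventually hev] with y hy
    rw [hφ.apply_symm] at hy
    exact ⟨hy.1, hy.2.2⟩
  obtain ⟨ε, hε, hball⟩ := Metric.eventually_nhds_iff_ball.1 hev'
  let j := otherIdx i
  let D : Set (Fin 2 → ℝ) := Metric.ball (φ q) ε
  have hDc : Convex ℝ D := convex_ball _ _
  have himg : ∀ S : Set (Fin 2 → ℝ), φ.symm '' S = φ.source ∩ φ ⁻¹' S := by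
    intro S
    rw [φ.symm_image_eq_source_inter_preimage (hφ.1 ▸ subset_univ S)]
  have hop : ∀ S : Set (Fin 2 → ℝ), IsOpen S → IsOpen (φ.symm '' S) := by
    intro S hS
    rw [himg]
    exact φ.isOpen_inter_preimage hS
  have hlin : IsLinearMap ℝ fun y : Fin 2 → ℝ => y j := ⟨fun _ _ => rfl, fun _ _ => rfl⟩
  have hleaf : ∀ y ∈ D, φ.symm y ∈ B.leaf l ↔ y j = φ q j := by
    intro y hy
    rw [mem_leaf_iff_rel hq]
    refine ⟨(hball y hy).2, fun h => hφ.rel_of_coord_eq hqφ (hφ.symm_mem y) ?_⟩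
    rwa [hφ.apply_symm]
  have ho1 : IsOpen (D ∩ {y | φ q j < y j}) :=
    Metric.isOpen_ball.inter (isOpen_lt continuous_const (continuous_apply j))
  have ho2 : IsOpen (D ∩ {y | y j < φ q j}) :=
    Metric.isOpen_ball.inter (isOpen_lt (continuous_apply j) continuous_const)
  refine ⟨φ.symm '' D, φ.symm '' (D ∩ {y | φ q j < y j}), φ.symm '' (D ∩ {y | y j < φ q j}),
    ⟨hop _ Metric.isOpen_ball, hop _ ho1, hop _ ho2, ?_, ?_, ?_, ?_, ?_, ?_, ?_, ?_, ?_⟩, ?_, ?_⟩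
  · exact ((hDc.inter (convex_halfSpace_gt hlin _)).isPreconnected).image _
      hφ.continuous_symm.continuousOn
  · exact ((hDc.inter (convex_halfSpace_lt hlin _)).isPreconnected).image _
      hφ.continuous_symm.continuousOn
  · rw [disjoint_left]
    rintro _ ⟨y, ⟨hyD, hy⟩, rfl⟩ h
    exact (ne_of_gt hy) ((hleaf y hyD).1 h)
  · rw [disjoint_left]
    rintro _ ⟨y, ⟨hyD, hy⟩, rfl⟩ h
    exact (ne_of_lt hy) ((hleaf y hyD).1 h)
  · rw [himg, himg, disjoint_left]
    rintro x ⟨-, -, h1⟩ ⟨-, -, h2⟩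
    exact lt_asymm (show φ q j < φ x j from h1) h2
  · exact image_mono inter_subset_left
  · exact image_mono inter_subset_left
  · rintro _ ⟨y, hy, rfl⟩
    rw [hleaf y hy]
    rcases lt_trichotomy (φ q j) (y j) with h | h | h
    · exact Or.inl ⟨y, ⟨hy, h⟩, rfl⟩
    · exact Or.inr (Or.inl h.symm)
    · exact Or.inr (Or.inr ⟨y, ⟨hy, h⟩, rfl⟩)
  · rintro p ⟨hpV, hpl⟩
    obtain ⟨y, hyD, rfl⟩ := hpV
    have hyj := (hleaf y hyD).1 hpl
    have hpφ := hφ.symm_mem y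
    have e1 : φ.symm '' D ∈ 𝓝 (φ.symm y) := (hop _ Metric.isOpen_ball).mem_nhds ⟨y, hyD, rfl⟩
    rw [himg] at e1
    have e2 := hφ.eventually_coord_eq j hpφ
    have hcoord : φ (φ.symm y) j = φ q j := by rw [hφ.apply_symm, hyj]
    filter_upwards [e1, e2] with x hx hxc
    rw [himg, himg]
    constructor
    · intro h
      have := hxc ((B.fol j).rel.symm ((B.fol j).rel_of_ahead _ _ h))
      have := (hφ.ahead_iff hpφ hx.1 this).1 h
      exact ⟨hx.1, hx.2, show φ q j < φ x j by rw [← hcoord]; exact this⟩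
    · intro h
      have := hxc ((B.fol j).rel_of_ahead _ _ h)
      have := (hφ.ahead_iff hx.1 hpφ this.symm).1 h
      exact ⟨hx.1, hx.2, show φ x j < φ q j by rw [← hcoord]; exact this⟩
  · exact ⟨φ q, Metric.mem_ball_self hε, φ.left_inv hqφ⟩
  · rintro _ ⟨y, hy, rfl⟩
    exact (hball y hy).1

end BifoliatedPlane

/-! ### Connectedness of a side from its trace near the boundary -/

/-- If `F` and `G` are the two sides of a connected set `L` and `F` has a connected trace near each
point of `L`, then `F` is connected. -/
theorem isPreconnected_of_collar {X : Type*} [TopologicalSpace X] [LocallyConnectedSpace X]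
    [PreconnectedSpace X] {L F G : Set X} (hL : IsPreconnected L) (hLn : L.Nonempty)
    (hF : IsOpen F) (hG : IsOpen G) (hFG : Disjoint F G) (hun : F ∪ G = Lᶜ)
    (hV : ∀ q ∈ L, ∃ V ∈ 𝓝 q, ∃ V₁ ⊆ F, IsPreconnected V₁ ∧ V ∩ F ⊆ V₁ ∧ V ∩ L ⊆ closure V₁) :
    IsPreconnected F := by
  have hFL : ∀ x ∈ F, x ∉ L := fun x hx => (hun ▸ Or.inl hx : x ∈ Lᶜ)
  -- A component of `F` adherent to `q` meets the connected set `V₁`, so it contains the whole trace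
  -- of `F` near `q`.
  have absorb : ∀ x, ∀ q ∈ L, q ∈ closure (connectedComponentIn F x) →
      ∃ V ∈ 𝓝 q, ∃ V₁ ⊆ connectedComponentIn F x, V ∩ F ⊆ V₁ ∧ V ∩ L ⊆ closure V₁ := by
    intro x q hq hqC
    obtain ⟨V, hVq, V₁, hV₁F, hV₁, hVF, hVL⟩ := hV q hq
    refine ⟨V, hVq, V₁, ?_, hVF, hVL⟩
    obtain ⟨z, hzV, hzC⟩ := mem_closure_iff_nhds.1 hqC V hVq
    have hzV₁ := hVF ⟨hzV, connectedComponentIn_subset _ _ hzC⟩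
    rw [connectedComponentIn_eq hzC]
    exact hV₁.subset_connectedComponentIn hzV₁ hV₁F
  -- A component adherent to no point of `L` would be clopen in the whole space. By `absorb`, the
  -- adherent points form an open subset of `L`, and a closed one, hence all of `L`.
  have adh : ∀ x ∈ F, L ⊆ closure (connectedComponentIn F x) := by
    intro x hx
    let C := connectedComponentIn F x
    have hCo : IsOpen C := hF.connectedComponentIn
    have hxC : x ∈ C := mem_connectedComponentIn hx
    have hne : (L ∩ closure C).Nonempty := by
      by_contra hemp
      have hcl : closure C ⊆ C := by
        intro y hy
        by_cases hyF : y ∈ F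
        · obtain ⟨z, hz1, hz2⟩ := mem_closure_iff_nhds.1 hy _
            (hF.connectedComponentIn.mem_nhds (mem_connectedComponentIn hyF))
          have : C = connectedComponentIn F y :=
            (connectedComponentIn_eq hz2).trans (connectedComponentIn_eq hz1).symm
          rw [this]
          exact mem_connectedComponentIn hyF
        · by_cases hyL : y ∈ L
          · exact (hemp ⟨y, hyL, hy⟩).elim
          · have hyG : y ∈ G := by
              have : y ∈ F ∪ G := hun ▸ hyL
              exact this.resolve_left hyF
            obtain ⟨z, hz1, hz2⟩ := mem_closure_iff_nhds.1 hy _ (hG.mem_nhds hyG)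
            exact (disjoint_left.1 hFG (connectedComponentIn_subset _ _ hz2) hz1).elim
      have hclopen : IsClopen C := ⟨isClosed_of_closure_subset hcl, hCo⟩
      have huniv := hclopen.eq_univ ⟨x, hxC⟩
      obtain ⟨a, ha⟩ := hLn
      exact hFL a (connectedComponentIn_subset F x (huniv ▸ mem_univ a : a ∈ C)) ha
    intro y hyL
    by_contra hy
    let O : Set X := {q | ∃ V, IsOpen V ∧ q ∈ V ∧ V ∩ L ⊆ closure C}
    have hO : IsOpen O := isOpen_iff_forall_mem_open.2 fun q ⟨V, hV1, hV2, hV3⟩ =>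
      ⟨V, fun z hz => ⟨V, hV1, hz, hV3⟩, hV1, hV2⟩
    have hmem : ∀ q ∈ L, q ∈ closure C → q ∈ O := by
      intro q hq hqC
      obtain ⟨V, hVq, V₁, hV₁C, -, hVL⟩ := absorb x q hq hqC
      obtain ⟨W, hWV, hW, hqW⟩ := mem_nhds_iff.1 hVq
      exact ⟨W, hW, hqW, fun z hz => closure_mono hV₁C (hVL ⟨hWV hz.1, hz.2⟩)⟩
    obtain ⟨q, hqL, hqC⟩ := hne
    obtain ⟨z, hzL, ⟨V, -, hzV, hVL⟩, hzC⟩ := hL O (closure C)ᶜ hO isClosed_closure.isOpen_compl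
      (fun z hz => (em (z ∈ closure C)).imp (hmem z hz) id) ⟨q, hqL, hmem q hqL hqC⟩ ⟨y, hyL, hy⟩
    exact hzC (hVL ⟨hzV, hzL⟩)
  rcases F.eq_empty_or_nonempty with rfl | ⟨x, hx⟩
  · exact isPreconnected_empty
  obtain ⟨q, hq⟩ := hLn
  -- All components are adherent to the same point `q`, so they all contain points of one `V₁`.
  have hFC : F ⊆ connectedComponentIn F x := by
    intro y hy
    obtain ⟨V, hVq, V₁, hV₁, hVF, -⟩ := absorb x q hq (adh x hx hq)
    obtain ⟨z, hzV, hzC⟩ := mem_closure_iff_nhds.1 (adh y hy hq) V hVq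
    have hz := hV₁ (hVF ⟨hzV, connectedComponentIn_subset _ _ hzC⟩)
    rw [connectedComponentIn_eq hz, ← connectedComponentIn_eq hzC]
    exact mem_connectedComponentIn hy
  rw [hFC.antisymm (connectedComponentIn_subset F x)]
  exact isPreconnected_connectedComponentIn

/-! ### The two sides of a leaf -/

namespace BifoliatedPlane

variable {P : Type*} [TopologicalSpace P] {B : BifoliatedPlane P}

/-- The two sides of a small box are contained in the corresponding sides of a larger one. -/
theorem IsSidedBox.mono {i : Fin 2} {l : B.LeafSpace i} {V V₁ V₂ U U₁ U₂ : Set P}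
    (hV : IsSidedBox l V V₁ V₂) (hU : IsSidedBox l U U₁ U₂) (hVU : V ⊆ U) {q : P} (hqV : q ∈ V)
    (hq : q ∈ B.leaf l) : V₁ ⊆ U₁ ∧ V₂ ⊆ U₂ := by
  have e1 := hV.eventually q ⟨hqV, hq⟩
  have e2 := hU.eventually q ⟨hVU hqV, hq⟩
  -- Points just ahead of `q` are in both `V₁` and `U₁`, points just behind in both `V₂` and `U₂`;
  -- connectedness does the rest.
  obtain ⟨f1, f2⟩ := frequently_ahead (B := B) (otherIdx i) q
  obtain ⟨x, hx, hxV, hxU⟩ := (f1.and_eventually (e1.and e2)).exists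
  obtain ⟨y, hy, hyV, hyU⟩ := (f2.and_eventually (e1.and e2)).exists
  constructor
  · refine hV.isPreconnected₁.subset_left_of_subset_union hU.isOpen₁ hU.isOpen₂
      hU.disjoint ?_ ⟨x, hxV.1 hx, hxU.1 hx⟩
    intro z hz
    rcases hU.mem_or z (hVU (hV.subset₁ hz)) with h | h | h
    · exact Or.inl h
    · exact (disjoint_left.1 hV.disjoint₁ hz h).elim
    · exact Or.inr h
  · refine hV.isPreconnected₂.subset_left_of_subset_union hU.isOpen₂ hU.isOpen₁
      hU.disjoint.symm ?_ ⟨y, hyV.2 hy, hyU.2 hy⟩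
    intro z hz
    rcases hU.mem_or z (hVU (hV.subset₂ hz)) with h | h | h
    · exact Or.inr h
    · exact (disjoint_left.1 hV.disjoint₂ hz h).elim
    · exact Or.inl h

/-- A leaf has a system of boxes whose opposite sides are disjoint. -/
theorem exists_coherent_boxes {i : Fin 2} (l : B.LeafSpace i) : ∃ V V₁ V₂ : P → Set P,
    (∀ q ∈ B.leaf l, IsSidedBox l (V q) (V₁ q) (V₂ q) ∧ q ∈ V q) ∧
    ∀ p ∈ B.leaf l, ∀ q ∈ B.leaf l, Disjoint (V₁ p) (V₂ q) := by
  have := B.metrizableSpace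
  let := TopologicalSpace.metrizableSpaceMetric P
  choose! U U₁ U₂ hU hqU hUO using fun (q : P) (hq : q ∈ B.leaf l) =>
    exists_isSidedBox hq univ_mem
  have hball : ∀ q ∈ B.leaf l, ∃ r > 0, Metric.ball q r ⊆ U q := fun q hq =>
    Metric.mem_nhds_iff.1 ((hU q hq).isOpen.mem_nhds (hqU q hq))
  choose! r hr hrU using hball
  -- With a third of the radius, two small boxes that meet both lie in the large box of the centre
  -- with the larger radius, where their sides can be compared.
  choose! V V₁ V₂ hV hqV hVO using fun (q : P) (hq : q ∈ B.leaf l) =>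
    exists_isSidedBox hq (Metric.ball_mem_nhds q (div_pos (hr q hq) three_pos))
  have hsub : ∀ p ∈ B.leaf l, ∀ q ∈ B.leaf l, (V p ∩ V q).Nonempty → r p ≤ r q →
      V p ⊆ U q := by
    rintro p hp q hq ⟨x, hxp, hxq⟩ hpq y hy
    refine hrU q hq ?_
    have h1 := Metric.mem_ball.1 (hVO p hp hxp)
    have h2 := Metric.mem_ball.1 (hVO q hq hxq)
    have h3 := Metric.mem_ball.1 (hVO p hp hy)
    rw [Metric.mem_ball]
    have h4 := dist_triangle y p q
    have h5 := dist_triangle_left p q x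
    linarith
  have hself : ∀ p ∈ B.leaf l, V p ⊆ U p := fun p hp =>
    hsub p hp p hp ⟨p, hqV p hp, hqV p hp⟩ le_rfl
  refine ⟨V, V₁, V₂, fun q hq => ⟨hV q hq, hqV q hq⟩, fun p hp q hq => ?_⟩
  rw [disjoint_left]
  intro x hxp hxq
  have hne : (V p ∩ V q).Nonempty := ⟨x, (hV p hp).subset₁ hxp, (hV q hq).subset₂ hxq⟩
  rcases le_total (r p) (r q) with h | h
  · have h1 := ((hV p hp).mono (hU q hq) (hsub p hp q hq hne h) (hqV p hp) hp).1 hxp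
    have h2 := ((hV q hq).mono (hU q hq) (hself q hq) (hqV q hq) hq).2 hxq
    exact disjoint_left.1 (hU q hq).disjoint h1 h2
  · rw [inter_comm] at hne
    have h1 := ((hV p hp).mono (hU p hp) (hself p hp) (hqV p hp) hp).1 hxp
    have h2 := ((hV q hq).mono (hU p hp) (hsub q hq p hp hne h) (hqV q hq) hq).2 hxq
    exact disjoint_left.1 (hU p hp).disjoint h1 h2

/-- `F` and `G` are the two sides of the leaf `l`, the transverse leaves passing from `G` to `F`. -/
structure IsSides {i : Fin 2} (l : B.LeafSpace i) (F G : Set P) : Prop where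
  isOpen₁ : IsOpen F
  isOpen₂ : IsOpen G
  disjoint : Disjoint F G
  union_eq : F ∪ G = (B.leaf l)ᶜ
  eventually : ∀ p ∈ B.leaf l, ∀ᶠ x in 𝓝 p, ((B.fol (otherIdx i)).ahead p x → x ∈ F) ∧
    ((B.fol (otherIdx i)).ahead x p → x ∈ G)

theorem exists_isSides {i : Fin 2} (l : B.LeafSpace i) : ∃ F G, IsSides l F G := by
  have := B.metrizableSpace
  have := B.contractibleSpace
  have := B.locallyPathConnectedSpace
  obtain ⟨V, V₁, V₂, hV, hdisj⟩ := exists_coherent_boxes l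
  obtain ⟨F, G, hF, hG, hFG, hun, hloc⟩ := exists_separation_of_two_sided (isClosed_leaf l)
    (isPreconnected_leaf l) (leaf_nonempty l) (N₁ := ⋃ q ∈ B.leaf l, V₁ q)
    (N₂ := ⋃ q ∈ B.leaf l, V₂ q) (isOpen_biUnion fun q hq => (hV q hq).1.isOpen₁)
    (isOpen_biUnion fun q hq => (hV q hq).1.isOpen₂)
    (by
      simp only [disjoint_iUnion_left, disjoint_iUnion_right]
      exact fun q hq p hp => hdisj p hp q hq)
    (by
      simp only [disjoint_iUnion_right]
      exact fun q hq => (hV q hq).1.disjoint₁.symm)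
    (by
      simp only [disjoint_iUnion_right]
      exact fun q hq => (hV q hq).1.disjoint₂.symm)
    (by
      have : (⋃ q ∈ B.leaf l, V₁ q) ∪ B.leaf l ∪ (⋃ q ∈ B.leaf l, V₂ q) =
          ⋃ q ∈ B.leaf l, V q := by
        apply Subset.antisymm
        · rintro x ((hx | hx) | hx)
          · obtain ⟨q, hq, hx⟩ := mem_iUnion₂.1 hx
            exact mem_iUnion₂.2 ⟨q, hq, (hV q hq).1.subset₁ hx⟩
          · exact mem_iUnion₂.2 ⟨x, hx, (hV x hx).2⟩
          · obtain ⟨q, hq, hx⟩ := mem_iUnion₂.1 hx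
            exact mem_iUnion₂.2 ⟨q, hq, (hV q hq).1.subset₂ hx⟩
        · intro x hx
          obtain ⟨q, hq, hx⟩ := mem_iUnion₂.1 hx
          rcases (hV q hq).1.mem_or x hx with h | h | h
          · exact Or.inl (Or.inl (mem_iUnion₂.2 ⟨q, hq, h⟩))
          · exact Or.inl (Or.inr h)
          · exact Or.inr (mem_iUnion₂.2 ⟨q, hq, h⟩)
      rw [this]
      exact isOpen_biUnion fun q hq => (hV q hq).1.isOpen)
  refine ⟨F, G, hF, hG, hFG, hun, fun p hp => ?_⟩
  obtain ⟨W, hW, hW1, hW2⟩ := hloc p hp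
  filter_upwards [hW, (hV p hp).1.eventually p ⟨(hV p hp).2, hp⟩] with x hxW hx
  exact ⟨fun h => hW1 ⟨hxW, mem_iUnion₂.2 ⟨p, hp, hx.1 h⟩⟩,
    fun h => hW2 ⟨hxW, mem_iUnion₂.2 ⟨p, hp, hx.2 h⟩⟩⟩

namespace IsSides

variable {i : Fin 2} {l : B.LeafSpace i} {F G : Set P}

theorem subset_compl₁ (h : IsSides l F G) : F ⊆ (B.leaf l)ᶜ :=
  h.union_eq ▸ subset_union_left

theorem subset_compl₂ (h : IsSides l F G) : G ⊆ (B.leaf l)ᶜ :=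
  h.union_eq ▸ subset_union_right

theorem mem_or (h : IsSides l F G) (x : P) : x ∈ F ∨ x ∈ B.leaf l ∨ x ∈ G := by
  by_cases hx : x ∈ B.leaf l
  · exact Or.inr (Or.inl hx)
  · rw [← mem_compl_iff, ← h.union_eq] at hx
    rcases hx with hx | hx
    · exact Or.inl hx
    · exact Or.inr (Or.inr hx)

theorem subset_or (h : IsSides l F G) {S : Set P} (hS : IsPreconnected S)
    (hd : Disjoint S (B.leaf l)) : S ⊆ F ∨ S ⊆ G := by
  have hsub : S ⊆ F ∪ G := h.union_eq ▸ hd.subset_compl_right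
  exact hS.subset_or_subset h.isOpen₁ h.isOpen₂ h.disjoint hsub

theorem subset₁_of_mem (h : IsSides l F G) {S : Set P} (hS : IsPreconnected S)
    (hd : Disjoint S (B.leaf l)) {x : P} (hx : x ∈ S) (hxF : x ∈ F) : S ⊆ F :=
  (h.subset_or hS hd).resolve_right fun h' => disjoint_left.1 h.disjoint hxF (h' hx)

theorem subset₂_of_mem (h : IsSides l F G) {S : Set P} (hS : IsPreconnected S)
    (hd : Disjoint S (B.leaf l)) {x : P} (hx : x ∈ S) (hxG : x ∈ G) : S ⊆ G :=
  (h.subset_or hS hd).resolve_left fun h' => disjoint_left.1 h.disjoint (h' hx) hxG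

theorem isPreconnected (h : IsSides l F G) : IsPreconnected F ∧ IsPreconnected G := by
  have := B.contractibleSpace
  have := B.locallyPathConnectedSpace
  have key : ∀ q ∈ B.leaf l, ∃ V ∈ 𝓝 q, (∃ V₁ ⊆ F, IsPreconnected V₁ ∧ V ∩ F ⊆ V₁ ∧
      V ∩ B.leaf l ⊆ closure V₁) ∧ ∃ V₂ ⊆ G, IsPreconnected V₂ ∧ V ∩ G ⊆ V₂ ∧
      V ∩ B.leaf l ⊆ closure V₂ := by
    intro q hq
    obtain ⟨V, V₁, V₂, hV, hqV, -⟩ := exists_isSidedBox hq univ_mem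
    have e := (hV.eventually q ⟨hqV, hq⟩).and (h.eventually q hq)
    obtain ⟨f1, f2⟩ := frequently_ahead (B := B) (otherIdx i) q
    obtain ⟨x, hx, hxV, hxF⟩ := (f1.and_eventually e).exists
    obtain ⟨y, hy, hyV, hyF⟩ := (f2.and_eventually e).exists
    have h1 : V₁ ⊆ F := h.subset₁_of_mem hV.isPreconnected₁ hV.disjoint₁ (hxV.1 hx) (hxF.1 hx)
    have h2 : V₂ ⊆ G := h.subset₂_of_mem hV.isPreconnected₂ hV.disjoint₂ (hyV.2 hy) (hyF.2 hy)
    refine ⟨V, hV.isOpen.mem_nhds hqV, ⟨V₁, h1, hV.isPreconnected₁, ?_, ?_⟩,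
      ⟨V₂, h2, hV.isPreconnected₂, ?_, ?_⟩⟩
    · rintro z ⟨hzV, hzF⟩
      rcases hV.mem_or z hzV with h' | h' | h'
      · exact h'
      · exact (h.subset_compl₁ hzF h').elim
      · exact (disjoint_left.1 h.disjoint hzF (h2 h')).elim
    · intro z hz
      rw [mem_closure_iff_frequently]
      exact ((frequently_ahead (B := B) (otherIdx i) z).1.and_eventually
        (hV.eventually z hz)).mono fun w hw => hw.2.1 hw.1
    · rintro z ⟨hzV, hzG⟩
      rcases hV.mem_or z hzV with h' | h' | h'
      · exact (disjoint_left.1 h.disjoint (h1 h') hzG).elim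
      · exact (h.subset_compl₂ hzG h').elim
      · exact h'
    · intro z hz
      rw [mem_closure_iff_frequently]
      exact ((frequently_ahead (B := B) (otherIdx i) z).2.and_eventually
        (hV.eventually z hz)).mono fun w hw => hw.2.2 hw.1
  constructor
  · refine isPreconnected_of_collar (isPreconnected_leaf l) (leaf_nonempty l) h.isOpen₁ h.isOpen₂
      h.disjoint h.union_eq fun q hq => ?_
    obtain ⟨V, hV, ⟨V₁, hV₁⟩, -⟩ := key q hq
    exact ⟨V, hV, V₁, hV₁⟩
  · refine isPreconnected_of_collar (isPreconnected_leaf l) (leaf_nonempty l) h.isOpen₂ h.isOpen₁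
      h.disjoint.symm (union_comm F G ▸ h.union_eq) fun q hq => ?_
    obtain ⟨V, hV, -, V₂, hV₂⟩ := key q hq
    exact ⟨V, hV, V₂, hV₂⟩

/-- A transverse leaf crosses a leaf once, from the second side to the first. -/
theorem mem_of_ahead (h : IsSides l F G) {p x : P} (hp : p ∈ B.leaf l) :
    ((B.fol (otherIdx i)).ahead p x → x ∈ F) ∧ ((B.fol (otherIdx i)).ahead x p → x ∈ G) := by
  obtain ⟨c, hc, hr, ha⟩ := exists_param_leaf (B.proj (otherIdx i) p)
  obtain ⟨s, rfl⟩ : p ∈ range c := hr ▸ mem_leaf_proj_self _ p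
  have ev : ∀ t, c t ∈ B.leaf l → ∀ᶠ t' in 𝓝 t, (t < t' → c t' ∈ F) ∧ (t' < t → c t' ∈ G) := by
    intro t ht
    filter_upwards [(hc.continuous.tendsto t).eventually (h.eventually _ ht)] with t' ht'
    rwa [ha, ha] at ht'
  -- At the first parameter after `s` outside `F`, the leaf would have to be on `l`; but it arrives
  -- there from `F`, whereas every crossing comes from `G`.
  have no_return : ∀ s t, s < t → c s ∈ B.leaf l → c t ∈ F := by
    clear hp
    intro s t hst hs
    by_contra ht
    let A : Set ℝ := {r | s < r ∧ c r ∉ F}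
    have hbdd : BddBelow A := ⟨s, fun r hr => hr.1.le⟩
    have htA : t ∈ A := ⟨hst, ht⟩
    obtain ⟨ε, hε, hball⟩ := Metric.eventually_nhds_iff_ball.1 (ev s hs)
    have hlow : ∀ r ∈ A, s + ε ≤ r := by
      rintro r ⟨hr1, hr2⟩
      by_contra hlt
      refine hr2 ((hball r ?_).1 hr1)
      rw [Real.ball_eq_Ioo]
      constructor <;> linarith
    have hclosed : IsClosed (A ∩ Ici (s + ε)) := by
      have : A ∩ Ici (s + ε) = Ici (s + ε) ∩ (c ⁻¹' F)ᶜ := by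
        ext r
        simp only [A, mem_inter_iff, mem_ofPred_eq, mem_Ici, mem_compl_iff, mem_preimage]
        constructor
        · tauto
        · rintro ⟨h1, h2⟩
          exact ⟨⟨by linarith, h2⟩, h1⟩
      rw [this]
      exact isClosed_Ici.inter (h.isOpen₁.preimage hc.continuous).isClosed_compl
    -- The gap `ε` after `s` makes `A` closed, so its infimum is attained.
    have hA : A ∩ Ici (s + ε) = A := inter_eq_left.2 hlow
    rw [hA] at hclosed
    have hm : sInf A ∈ A := hclosed.csInf_mem ⟨t, htA⟩ hbdd
    have hmin : ∀ r, s < r → r < sInf A → c r ∈ F := by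
      intro r hr hr'
      by_contra hrF
      exact absurd (csInf_le hbdd (show r ∈ A from ⟨hr, hrF⟩)) (not_le.2 hr')
    have hfreq : ∃ᶠ r in 𝓝 (sInf A), r < sInf A ∧ c r ∈ F := by
      have : ∀ᶠ r in 𝓝 (sInf A), s < r := lt_mem_nhds hm.1
      exact ((frequently_lt_nhds (sInf A)).and_eventually this).mono
        fun r hr => ⟨hr.1, hmin r hr.2 hr.1⟩
    rcases h.mem_or (c (sInf A)) with h' | h' | h'
    · exact hm.2 h'
    · obtain ⟨r, ⟨hr1, hr2⟩, hr3⟩ := (hfreq.and_eventually (ev _ h')).exists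
      exact disjoint_left.1 h.disjoint hr2 (hr3.2 hr1)
    · obtain ⟨r, ⟨hr1, hr2⟩, hr3⟩ := (hfreq.and_eventually
        (hc.continuous.continuousAt (h.isOpen₂.mem_nhds h'))).exists
      exact disjoint_left.1 h.disjoint hr2 hr3
  constructor
  · intro hx
    obtain ⟨t, rfl⟩ : x ∈ range c :=
      hr ▸ mem_leaf_proj.2 ((B.fol _).rel.symm ((B.fol _).rel_of_ahead _ _ hx))
    exact no_return s t ((ha _ _).1 hx) hp
  · intro hx
    obtain ⟨t, rfl⟩ : x ∈ range c := hr ▸ mem_leaf_proj.2 ((B.fol _).rel_of_ahead _ _ hx)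
    have hts := (ha _ _).1 hx
    -- An earlier crossing would put `c s` in `F`, although it lies on `l`.
    have hnl : ∀ r < s, c r ∉ B.leaf l := fun r hr hrl =>
      h.subset_compl₁ (no_return r s hr hrl) hp
    obtain ⟨r, hr1, hr2⟩ := ((frequently_lt_nhds s).and_eventually (ev s hp)).exists
    refine h.subset₂_of_mem (S := c '' Iio s) (isPreconnected_Iio.image c hc.continuous.continuousOn)
      ?_ ⟨r, hr1, rfl⟩ (hr2.2 hr1) ⟨t, hts, rfl⟩
    rw [disjoint_left]
    rintro _ ⟨r, hr, rfl⟩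
    exact hnl r hr

end IsSides

theorem mem_leaf_unique {i : Fin 2} {l : B.LeafSpace i} {p q : P} (hp : p ∈ B.leaf l)
    (hq : q ∈ B.leaf l) (h : (B.fol (otherIdx i)).rel p q) : p = q := by
  obtain ⟨F, G, hs⟩ := exists_isSides l
  rcases ahead_trichotomy h with h | h | h
  · exact (hs.subset_compl₁ ((hs.mem_of_ahead hp).1 h) hq).elim
  · exact h
  · exact (hs.subset_compl₁ ((hs.mem_of_ahead hq).1 h) hp).elim

theorem IsSides.mem₁_iff {i : Fin 2} {l : B.LeafSpace i} {F G : Set P} (h : IsSides l F G)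
    {p x : P} (hp : p ∈ B.leaf l) (hx : (B.fol (otherIdx i)).rel p x) :
    x ∈ F ↔ (B.fol (otherIdx i)).ahead p x := by
  refine ⟨fun hxF => ?_, (h.mem_of_ahead hp).1⟩
  rcases ahead_trichotomy hx with h' | rfl | h'
  · exact h'
  · exact (h.subset_compl₁ hxF hp).elim
  · exact (disjoint_left.1 h.disjoint hxF ((h.mem_of_ahead hp).2 h')).elim

theorem IsSides.mem₂_iff {i : Fin 2} {l : B.LeafSpace i} {F G : Set P} (h : IsSides l F G)
    {p x : P} (hp : p ∈ B.leaf l) (hx : (B.fol (otherIdx i)).rel p x) :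
    x ∈ G ↔ (B.fol (otherIdx i)).ahead x p := by
  refine ⟨fun hxG => ?_, (h.mem_of_ahead hp).2⟩
  rcases ahead_trichotomy hx with h' | rfl | h'
  · exact (disjoint_left.1 h.disjoint ((h.mem_of_ahead hp).1 h') hxG).elim
  · exact (h.subset_compl₂ hxG hp).elim
  · exact h'

/-! ### The topology of the leaf space -/

theorem continuous_proj (B : BifoliatedPlane P) (i : Fin 2) : Continuous (B.proj i) :=
  continuous_quotient_mk'

theorem isOpen_leafSpace_iff {i : Fin 2} {S : Set (B.LeafSpace i)} :
    IsOpen S ↔ IsOpen (B.proj i ⁻¹' S) := Iff.rfl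

theorem proj_surjective (B : BifoliatedPlane P) (i : Fin 2) : Function.Surjective (B.proj i) :=
  Quotient.mk_surjective

theorem proj_eq_iff {i : Fin 2} {p q : P} : B.proj i p = B.proj i q ↔ (B.fol i).rel p q :=
  mem_leaf_proj (B := B)

/-- In a chart, the leaves near that of `p` cross any given neighbourhood of a point `q` of the
plaque of `p`, on the transverse plaque of `q`. -/
theorem IsFoliatedChart.eventually_exists {φ : OpenPartialHomeomorph P (Fin 2 → ℝ)}
    (hφ : B.IsFoliatedChart φ) {i : Fin 2} {p q : P} (hp : p ∈ φ.source) (hq : q ∈ φ.source)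
    (hpq : φ p (otherIdx i) = φ q (otherIdx i)) {O : Set P} (hO : O ∈ 𝓝 q) :
    ∀ᶠ x in 𝓝 p, ∃ y ∈ O, (B.fol i).rel x y ∧ (B.fol (otherIdx i)).rel y q := by
  -- `f` slides `x` along its plaque to the transverse plaque of `q`.
  let f : P → P := fun x => φ.symm (Function.update (φ q) (otherIdx i) (φ x (otherIdx i)))
  have hcont : ContinuousAt f p := by
    refine hφ.continuous_symm.continuousAt.comp ?_
    refine continuousAt_const.update _ ?_
    exact (continuous_apply _).continuousAt.comp (φ.continuousAt hp)
  have hfp : f p = q := by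
    simp only [f]
    rw [hpq, Function.update_eq_self, φ.left_inv hq]
  have hc : Tendsto f (𝓝 p) (𝓝 q) := by
    have := hcont.tendsto
    rwa [hfp] at this
  filter_upwards [hc hO, φ.open_source.mem_nhds hp] with x hxO hx
  refine ⟨f x, hxO, hφ.rel_of_coord_eq (hφ.symm_mem _) hx ?_,
    hφ.rel_of_coord_eq hq (hφ.symm_mem _) ?_⟩
  · rw [hφ.apply_symm, Function.update_self]
  · rw [hφ.apply_symm, otherIdx_otherIdx, Function.update_of_ne (otherIdx_ne i).symm]

/-- The saturation of an open set is open because openness propagates along a leaf: the parameters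
at which the leaf is interior to the saturation form a clopen subset of `ℝ`. -/
theorem isOpenMap_proj (B : BifoliatedPlane P) (i : Fin 2) : IsOpenMap (B.proj i) := by
  intro U hU
  rw [isOpen_leafSpace_iff]
  let S := B.proj i ⁻¹' (B.proj i '' U)
  have hsat : ∀ x y, y ∈ S → (B.fol i).rel x y → x ∈ S := by
    rintro x y ⟨u, hu, huy⟩ hxy
    exact ⟨u, hu, huy.trans (proj_eq_iff.2 ((B.fol i).rel.symm hxy))⟩
  change IsOpen S
  rw [isOpen_iff_mem_nhds]
  rintro x ⟨u, hu, hux⟩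
  obtain ⟨c, hc, hr, -⟩ := exists_param_leaf (B.proj i u)
  have hclosed : IsClosed (c ⁻¹' interior S) := by
    refine isClosed_of_closure_subset fun t ht => ?_
    obtain ⟨φ, hφ, htφ⟩ := exists_isFoliatedChart (B := B) (c t)
    have e := (hφ.eventually_coord_eq i htφ).and (φ.open_source.mem_nhds htφ)
    obtain ⟨r, hrS, hr1, hr2⟩ :=
      ((mem_closure_iff_frequently.1 ht).and_eventually (hc.continuous.continuousAt e)).exists
    have hrel : (B.fol i).rel (c r) (c t) :=
      (mem_leaf_iff_rel (hr ▸ mem_range_self t)).1 (hr ▸ mem_range_self r)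
    have := hφ.eventually_exists htφ hr2 (hr1 hrel).symm (isOpen_interior.mem_nhds hrS)
    refine mem_interior_iff_mem_nhds.2 (this.mono ?_)
    rintro x ⟨y, hy, hxy, -⟩
    exact hsat x y (interior_subset hy) hxy
  have huniv : c ⁻¹' interior S = univ := by
    refine IsClopen.eq_univ ⟨hclosed, isOpen_interior.preimage hc.continuous⟩ ?_
    obtain ⟨t, ht⟩ : u ∈ range c := hr ▸ mem_leaf_proj_self i u
    refine ⟨t, ?_⟩
    rw [mem_preimage, ht]
    exact interior_maximal (subset_preimage_image _ _) hU hu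
  obtain ⟨t, rfl⟩ : x ∈ range c := hr ▸ hux.symm
  exact mem_interior_iff_mem_nhds.1 (huniv ▸ mem_univ t : t ∈ c ⁻¹' interior S)

/-- A transverse leaf embeds as an open subset of the leaf space. -/
theorem isOpenEmbedding_proj_comp {i : Fin 2} {m : B.LeafSpace (otherIdx i)} {c : ℝ → P}
    (hc : IsClosedEmbedding c) (hr : range c = B.leaf m) : IsOpenEmbedding (B.proj i ∘ c) := by
  refine .of_continuous_injective_isOpenMap ((continuous_proj B i).comp hc.continuous) ?_ ?_
  · intro s t hst
    refine hc.injective (mem_leaf_unique (proj_eq_of_mem hst) (mem_leaf_proj_self i (c t)) ?_)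
    exact (mem_leaf_iff_rel (hr ▸ mem_range_self t)).1 (hr ▸ mem_range_self s)
  · intro J hJ
    rw [isOpen_iff_mem_nhds]
    rintro _ ⟨t, ht, rfl⟩
    obtain ⟨φ, hφ, htφ⟩ := exists_isFoliatedChart (B := B) (c t)
    obtain ⟨O, hO, hOJ⟩ : J ∈ comap c (𝓝 (c t)) :=
      hc.isInducing.nhds_eq_comap t ▸ hJ.mem_nhds ht
    refine mem_of_superset ((isOpenMap_proj B i).image_mem_nhds
      (hφ.eventually_exists (i := i) htφ htφ rfl hO)) ?_
    rintro _ ⟨x, ⟨y, hyO, hxy, hyt⟩, rfl⟩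
    obtain ⟨r, rfl⟩ : y ∈ range c := hr ▸ (mem_leaf_iff_rel (hr ▸ mem_range_self t)).2 hyt
    exact ⟨r, hOJ hyO, (proj_eq_iff.2 hxy).symm⟩

/-! ### Front and back are the two sides -/

theorem leafLT_of_ahead {i : Fin 2} {p q : P} (h : (B.fol (otherIdx i)).ahead p q) :
    B.LeafLT (B.proj i p) (B.proj i q) := by
  obtain ⟨c, hc, hr, ha⟩ := exists_param_leaf (B.proj (otherIdx i) q)
  obtain ⟨t, rfl⟩ : q ∈ range c := hr ▸ mem_leaf_proj_self _ q
  obtain ⟨s, rfl⟩ : p ∈ range c := hr ▸ mem_leaf_proj.2 ((B.fol _).rel_of_ahead _ _ h)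
  rw [ha] at h
  let a : unitInterval → ℝ := fun r => s + r * (t - s)
  have hac : Continuous a := by fun_prop
  have hmono : StrictMono a := fun x y hxy => by
    have : (x : ℝ) < y := hxy
    have := mul_lt_mul_of_pos_right this (sub_pos.2 h)
    simp only [a]
    linarith
  have hemb : IsEmbedding a := (hac.isClosedEmbedding hmono.injective).isEmbedding
  refine ⟨fun r => B.proj i (c (a r)), (isOpenEmbedding_proj_comp hc hr).isEmbedding.comp hemb,
    fun r => ⟨univ, univ_mem, fun r => c (a r), (hc.continuous.comp hac).continuousOn,
      fun _ _ => rfl, fun x _ y _ hxy => (ha _ _).2 (hmono hxy)⟩, ?_, ?_⟩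
  · simp [a]
  · simp [a]

/-- A path in the leaf space is only locally lifted to `P`, so its side is followed in the leaf
space: the images of `F` and `G` are open, and no leaf on the path meets both sides. -/
theorem IsSides.of_proj_path {i : Fin 2} {l : B.LeafSpace i} {F G : Set P} (h : IsSides l F G)
    {γ : unitInterval → B.LeafSpace i} {S : Set unitInterval} (hS : IsPreconnected S)
    (hγ : Continuous γ) (hγl : ∀ t ∈ S, γ t ≠ l) :
    (∀ t ∈ S, B.leaf (γ t) ⊆ F) ∨ ∀ t ∈ S, B.leaf (γ t) ⊆ G := by
  have hleaf : ∀ t ∈ S, B.leaf (γ t) ⊆ F ∨ B.leaf (γ t) ⊆ G := fun t ht =>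
    h.subset_or (isPreconnected_leaf _) ((leaf_eq_or_disjoint (γ t) l).resolve_left (hγl t ht))
  have hproj : ∀ (m : B.LeafSpace i) (E : Set P), B.leaf m ⊆ E → m ∈ B.proj i '' E := by
    intro m E hE
    obtain ⟨p, rfl⟩ := proj_surjective B i m
    exact ⟨p, hE (mem_leaf_proj_self i p), rfl⟩
  have back : ∀ t ∈ S, γ t ∈ B.proj i '' F → γ t ∈ B.proj i '' G → False := by
    rintro t ht ⟨x, hx, hxt⟩ ⟨y, hy, hyt⟩
    rcases hleaf t ht with h' | h'
    · exact disjoint_left.1 h.disjoint (h' hyt) hy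
    · exact disjoint_left.1 h.disjoint hx (h' hxt)
  by_contra! hcon
  obtain ⟨⟨t, ht, htF⟩, r, hr, hrG⟩ := hcon
  obtain ⟨z, hz, hz1, hz2⟩ := hS (γ ⁻¹' (B.proj i '' F)) (γ ⁻¹' (B.proj i '' G))
    ((isOpenMap_proj B i _ h.isOpen₁).preimage hγ) ((isOpenMap_proj B i _ h.isOpen₂).preimage hγ)
    (fun t ht => (hleaf t ht).imp (hproj _ _) (hproj _ _))
    ⟨r, hr, hproj _ _ ((hleaf r hr).resolve_right hrG)⟩
    ⟨t, ht, hproj _ _ ((hleaf t ht).resolve_left htF)⟩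
  exact back z hz hz1 hz2

/-- The local lift at `0` moves ahead into `F`, and injectivity of the path keeps it off `l`
afterwards. -/
theorem IsSides.subset₁_of_leafLT {i : Fin 2} {l l' : B.LeafSpace i} {F G : Set P}
    (h : IsSides l F G) (hl : B.LeafLT l l') : B.leaf l' ⊆ F := by
  obtain ⟨γ, hγ, hor, rfl, rfl⟩ := hl
  obtain ⟨U, hU, c, hc, hcγ, hca⟩ := hor 0
  have h0 : (0 : unitInterval) ∈ U := mem_of_mem_nhds hU
  obtain ⟨t, ht0, htU⟩ : ∃ t : unitInterval, 0 < t ∧ t ∈ U := by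
    have : (𝓝[>] (0 : unitInterval)).NeBot := nhdsGT_neBot_of_exists_gt ⟨1, zero_lt_one⟩
    obtain ⟨t, ht⟩ := Filter.nonempty_of_mem (inter_mem self_mem_nhdsWithin
      (mem_nhdsWithin_of_mem_nhds hU) : Ioi 0 ∩ U ∈ 𝓝[>] (0 : unitInterval))
    exact ⟨t, ht⟩
  have hct : c t ∈ F := (h.mem_of_ahead (hcγ 0 h0)).1 (hca 0 h0 t htU ht0)
  rcases h.of_proj_path (S := Ioi 0) isPreconnected_Ioi hγ.continuous
    (fun t ht he => (ne_of_gt ht) (hγ.injective he)) with h' | h'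
  · exact h' 1 (mem_Ioi.2 zero_lt_one)
  · exact (disjoint_left.1 h.disjoint hct (h' t ht0 (hcγ t htU))).elim

theorem IsSides.subset₂_of_leafLT {i : Fin 2} {l l' : B.LeafSpace i} {F G : Set P}
    (h : IsSides l F G) (hl : B.LeafLT l' l) : B.leaf l' ⊆ G := by
  obtain ⟨γ, hγ, hor, rfl, rfl⟩ := hl
  obtain ⟨U, hU, c, hc, hcγ, hca⟩ := hor 1
  have h1 : (1 : unitInterval) ∈ U := mem_of_mem_nhds hU
  obtain ⟨t, ht0, htU⟩ : ∃ t : unitInterval, t < 1 ∧ t ∈ U := by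
    have : (𝓝[<] (1 : unitInterval)).NeBot := nhdsLT_neBot_of_exists_lt ⟨0, zero_lt_one⟩
    obtain ⟨t, ht⟩ := Filter.nonempty_of_mem (inter_mem self_mem_nhdsWithin
      (mem_nhdsWithin_of_mem_nhds hU) : Iio 1 ∩ U ∈ 𝓝[<] (1 : unitInterval))
    exact ⟨t, ht⟩
  have hct : c t ∈ G := (h.mem_of_ahead (hcγ 1 h1)).2 (hca t htU 1 h1 ht0)
  rcases h.of_proj_path (S := Iio 1) isPreconnected_Iio hγ.continuous
    (fun t ht he => (ne_of_lt ht) (hγ.injective he)) with h' | h'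
  · exact (disjoint_left.1 h.disjoint (h' t ht0 (hcγ t htU)) hct).elim
  · exact h' 0 (mem_Iio.2 zero_lt_one)

theorem IsSides.front_eq {i : Fin 2} {l : B.LeafSpace i} {F G : Set P} (h : IsSides l F G) :
    B.front l = F := by
  apply Subset.antisymm
  · rintro p ⟨l', hl, q, hq, hp⟩
    have hqF := h.subset₁_of_leafLT hl hq
    refine h.subset₁_of_mem isPreconnected_connectedComponentIn ?_
      (mem_connectedComponentIn (h.subset_compl₁ hqF)) hqF hp
    exact disjoint_left.2 fun x hx => connectedComponentIn_subset _ _ hx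
  · intro p hp
    obtain ⟨a, ha⟩ := leaf_nonempty l
    obtain ⟨x, hx⟩ := (frequently_ahead (B := B) (otherIdx i) a).1.exists
    refine ⟨B.proj i x, proj_eq_of_mem ha ▸ leafLT_of_ahead hx, x, mem_leaf_proj_self i x, ?_⟩
    exact h.isPreconnected.1.subset_connectedComponentIn ((h.mem_of_ahead ha).1 hx)
      h.subset_compl₁ hp

theorem IsSides.back_eq {i : Fin 2} {l : B.LeafSpace i} {F G : Set P} (h : IsSides l F G) :
    B.back l = G := by
  apply Subset.antisymm
  · rintro p ⟨l', hl, q, hq, hp⟩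
    have hqG := h.subset₂_of_leafLT hl hq
    refine h.subset₂_of_mem isPreconnected_connectedComponentIn ?_
      (mem_connectedComponentIn (h.subset_compl₂ hqG)) hqG hp
    exact disjoint_left.2 fun x hx => connectedComponentIn_subset _ _ hx
  · intro p hp
    obtain ⟨a, ha⟩ := leaf_nonempty l
    obtain ⟨x, hx⟩ := (frequently_ahead (B := B) (otherIdx i) a).2.exists
    refine ⟨B.proj i x, proj_eq_of_mem ha ▸ leafLT_of_ahead hx, x, mem_leaf_proj_self i x, ?_⟩
    exact h.isPreconnected.2.subset_connectedComponentIn ((h.mem_of_ahead ha).2 hx)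
      h.subset_compl₂ hp

/-- A leaf separates the plane into its front and its back. -/
theorem isSides_front_back {i : Fin 2} (l : B.LeafSpace i) :
    IsSides l (B.front l) (B.back l) := by
  obtain ⟨F, G, h⟩ := exists_isSides l
  rwa [h.front_eq, h.back_eq]

end BifoliatedPlane

/-! ### The order on non-separated leaves -/

theorem NonSeparated.symm {X : Type*} [TopologicalSpace X] {x y : X} (h : NonSeparated x y) :
    NonSeparated y x := fun U hU V hV => inter_comm V U ▸ h V hV U hU

namespace BifoliatedPlane

variable {P : Type*} [TopologicalSpace P] {B : BifoliatedPlane P} {i : Fin 2}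

theorem exists_crosses (l : B.LeafSpace i) : ∃ s : B.LeafSpace (otherIdx i), B.Crosses s l := by
  obtain ⟨p, hp⟩ := leaf_nonempty l
  exact ⟨B.proj _ p, p, mem_leaf_proj_self _ p, hp⟩

theorem isOpen_setOf_crosses (s : B.LeafSpace (otherIdx i)) :
    IsOpen {l : B.LeafSpace i | B.Crosses s l} := by
  obtain ⟨c, hc, hr, -⟩ := exists_param_leaf s
  convert (isOpenEmbedding_proj_comp hc hr).isOpen_range using 1
  rw [range_comp, hr]
  rfl

/-- The leaves crossing `s` form an open copy of `ℝ` in the leaf space, and its distinct points are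
separated. -/
theorem Crosses.not_crosses {l₁ l₂ : B.LeafSpace i} (hne : l₁ ≠ l₂) (h : NonSeparated l₁ l₂)
    {s : B.LeafSpace (otherIdx i)} (h₁ : B.Crosses s l₁) : ¬ B.Crosses s l₂ := by
  intro h₂
  obtain ⟨c, hc, hr, -⟩ := exists_param_leaf s
  have he := isOpenEmbedding_proj_comp hc hr
  obtain ⟨_, hx, rfl⟩ := h₁
  obtain ⟨_, hy, rfl⟩ := h₂
  obtain ⟨x, rfl⟩ := hr ▸ hx
  obtain ⟨y, rfl⟩ := hr ▸ hy
  obtain ⟨U, V, hU, hV, hxU, hyV, hUV⟩ := t2_separation (show x ≠ y by rintro rfl; exact hne rfl)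
  obtain ⟨_, ⟨a, ha, rfl⟩, b, hb, hab⟩ := h _ ((he.isOpenMap U hU).mem_nhds ⟨x, hxU, rfl⟩)
    _ ((he.isOpenMap V hV).mem_nhds ⟨y, hyV, rfl⟩)
  obtain rfl := he.injective hab
  exact disjoint_left.1 hUV ha hb

theorem Crosses.disjoint_leaf {l₁ l₂ : B.LeafSpace i} (hne : l₁ ≠ l₂) (h : NonSeparated l₁ l₂)
    {s : B.LeafSpace (otherIdx i)} (h₁ : B.Crosses s l₁) : Disjoint (B.leaf l₂) (B.leaf s) :=
  disjoint_left.2 fun x hx hx' => h₁.not_crosses hne h ⟨x, hx', hx⟩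

theorem Crosses.disjoint {l₁ l₂ : B.LeafSpace i} (hne : l₁ ≠ l₂) (h : NonSeparated l₁ l₂)
    {s₁ s₂ : B.LeafSpace (otherIdx i)} (h₁ : B.Crosses s₁ l₁) (h₂ : B.Crosses s₂ l₂) :
    Disjoint (B.leaf s₁) (B.leaf s₂) :=
  (leaf_eq_or_disjoint s₁ s₂).resolve_left fun he => h₁.not_crosses hne h (he ▸ h₂)

theorem IsSides.subset₁_iff {l : B.LeafSpace i} {F G S T : Set P} (h : IsSides l F G)
    (hS : IsPreconnected S) (hT : IsPreconnected T) (hSl : Disjoint S (B.leaf l))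
    (hTl : Disjoint T (B.leaf l)) (hST : (S ∩ T).Nonempty) : S ⊆ F ↔ T ⊆ F := by
  obtain ⟨x, hxS, hxT⟩ := hST
  exact ⟨fun hs => h.subset₁_of_mem hT hTl hxT (hs hxS),
    fun ht => h.subset₁_of_mem hS hSl hxS (ht hxT)⟩

theorem IsSides.subset₂_iff {l : B.LeafSpace i} {F G S T : Set P} (h : IsSides l F G)
    (hS : IsPreconnected S) (hT : IsPreconnected T) (hSl : Disjoint S (B.leaf l))
    (hTl : Disjoint T (B.leaf l)) (hST : (S ∩ T).Nonempty) : S ⊆ G ↔ T ⊆ G := by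
  obtain ⟨x, hxS, hxT⟩ := hST
  exact ⟨fun hs => h.subset₂_of_mem hT hTl hxT (hs hxS),
    fun ht => h.subset₂_of_mem hS hSl hxS (ht hxT)⟩

/-- Leaves transverse to `s` belong to the foliation `otherIdx (otherIdx i)`, which is identified
with `i` by rewriting. -/
theorem mem_front_iff {s : B.LeafSpace (otherIdx i)} {p x : P} (hp : p ∈ B.leaf s)
    (hx : (B.fol i).rel p x) : x ∈ B.front s ↔ (B.fol i).ahead p x := by
  have := (isSides_front_back s).mem₁_iff (x := x) hp
  rw [otherIdx_otherIdx] at this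
  exact this hx

theorem mem_back_iff {s : B.LeafSpace (otherIdx i)} {p x : P} (hp : p ∈ B.leaf s)
    (hx : (B.fol i).rel p x) : x ∈ B.back s ↔ (B.fol i).ahead x p := by
  have := (isSides_front_back s).mem₂_iff (x := x) hp
  rw [otherIdx_otherIdx] at this
  exact this hx

/-- Non-separation provides a leaf `l` crossing both `s₁` and `s₂`; either inclusion says that `l`
meets `s₁` before `s₂`. -/
theorem leaf_subset_back_iff_subset_front {l₁ l₂ : B.LeafSpace i} (hne : l₁ ≠ l₂)
    (h : NonSeparated l₁ l₂) {s₁ s₂ : B.LeafSpace (otherIdx i)} (h₁ : B.Crosses s₁ l₁)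
    (h₂ : B.Crosses s₂ l₂) : B.leaf s₁ ⊆ B.back s₂ ↔ B.leaf s₂ ⊆ B.front s₁ := by
  have hd := h₁.disjoint hne h h₂
  obtain ⟨l, ⟨x₁, hx₁, hx₁l⟩, x₂, hx₂, hx₂l⟩ := h _ ((isOpen_setOf_crosses s₁).mem_nhds h₁)
    _ ((isOpen_setOf_crosses s₂).mem_nhds h₂)
  have hrel : (B.fol i).rel x₁ x₂ := (mem_leaf_iff_rel hx₂l).1 hx₁l
  have e1 : B.leaf s₁ ⊆ B.back s₂ ↔ x₁ ∈ B.back s₂ :=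
    ⟨fun hs => hs hx₁, (isSides_front_back s₂).subset₂_of_mem (isPreconnected_leaf s₁) hd hx₁⟩
  have e2 : B.leaf s₂ ⊆ B.front s₁ ↔ x₂ ∈ B.front s₁ :=
    ⟨fun hs => hs hx₂, (isSides_front_back s₁).subset₁_of_mem (isPreconnected_leaf s₂) hd.symm hx₂⟩
  rw [e1, e2, mem_back_iff hx₂ ((B.fol i).rel.symm hrel), mem_front_iff hx₁ hrel]

theorem cataclysmLT_iff {l₁ l₂ : B.LeafSpace i} (hne : l₁ ≠ l₂)
    (h : NonSeparated l₁ l₂) {s₁ s₂ : B.LeafSpace (otherIdx i)} (h₁ : B.Crosses s₁ l₁)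
    (h₂ : B.Crosses s₂ l₂) : B.CataclysmLT l₁ l₂ ↔ B.leaf s₁ ⊆ B.back s₂ := by
  refine ⟨?_, fun hs => ⟨hne, h, s₁, s₂, h₁, h₂, hs⟩⟩
  rintro ⟨-, -, t₁, t₂, ht₁, ht₂, ht⟩
  -- Both `t₁` and `s₁` meet `l₁`, which is connected and disjoint from `t₂`. The second leaf is
  -- exchanged in the same way after passing to fronts by duality.
  have hback : B.leaf t₁ ⊆ B.back t₂ ↔ B.leaf s₁ ⊆ B.back t₂ := by
    have hl := ht₂.disjoint_leaf hne.symm h.symm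
    rw [(isSides_front_back t₂).subset₂_iff (isPreconnected_leaf t₁) (isPreconnected_leaf l₁)
      (ht₁.disjoint hne h ht₂) hl ht₁,
      (isSides_front_back t₂).subset₂_iff (isPreconnected_leaf s₁) (isPreconnected_leaf l₁)
      (h₁.disjoint hne h ht₂) hl h₁]
  have hfront : B.leaf t₂ ⊆ B.front s₁ ↔ B.leaf s₂ ⊆ B.front s₁ := by
    have hl := h₁.disjoint_leaf hne h
    rw [(isSides_front_back s₁).subset₁_iff (isPreconnected_leaf t₂) (isPreconnected_leaf l₂)
      (h₁.disjoint hne h ht₂).symm hl ht₂,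
      (isSides_front_back s₁).subset₁_iff (isPreconnected_leaf s₂) (isPreconnected_leaf l₂)
      (h₁.disjoint hne h h₂).symm hl h₂]
  rw [leaf_subset_back_iff_subset_front hne h h₁ h₂, ← hfront,
    ← leaf_subset_back_iff_subset_front hne h h₁ ht₂, ← hback]
  exact ht

theorem cataclysmLT_iff' {l₁ l₂ : B.LeafSpace i} (hne : l₁ ≠ l₂)
    (h : NonSeparated l₁ l₂) {s₁ s₂ : B.LeafSpace (otherIdx i)} (h₁ : B.Crosses s₁ l₁)
    (h₂ : B.Crosses s₂ l₂) : B.CataclysmLT l₂ l₁ ↔ B.leaf s₁ ⊆ B.front s₂ := by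
  rw [cataclysmLT_iff hne.symm h.symm h₂ h₁,
    leaf_subset_back_iff_subset_front hne.symm h.symm h₂ h₁]

theorem CataclysmLT.asymm {l₁ l₂ : B.LeafSpace i} (h : B.CataclysmLT l₁ l₂) :
    ¬ B.CataclysmLT l₂ l₁ := by
  obtain ⟨hne, hns, s₁, s₂, h₁, h₂, hs⟩ := h
  rw [cataclysmLT_iff' hne hns h₁ h₂]
  intro hs'
  obtain ⟨x, hx⟩ := leaf_nonempty s₁
  exact disjoint_left.1 (isSides_front_back s₂).disjoint (hs' hx) (hs hx)

theorem cataclysmLT_or {l₁ l₂ : B.LeafSpace i} (hne : l₁ ≠ l₂) (h : NonSeparated l₁ l₂) :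
    B.CataclysmLT l₁ l₂ ∨ B.CataclysmLT l₂ l₁ := by
  obtain ⟨s₁, h₁⟩ := exists_crosses l₁
  obtain ⟨s₂, h₂⟩ := exists_crosses l₂
  rw [cataclysmLT_iff hne h h₁ h₂, cataclysmLT_iff' hne h h₁ h₂]
  exact ((isSides_front_back s₂).subset_or (isPreconnected_leaf s₁)
    (h₁.disjoint hne h h₂)).symm

/-- The back of `s₁` is connected, avoids `s₂`, and reaches the back of `s₂` near any point of `s₁`.
-/
theorem back_subset_back {s₁ s₂ : B.LeafSpace (otherIdx i)} (h₁₂ : B.leaf s₁ ⊆ B.back s₂)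
    (h₂₁ : B.leaf s₂ ⊆ B.front s₁) : B.back s₁ ⊆ B.back s₂ := by
  have hs₁ := isSides_front_back s₁
  have hs₂ := isSides_front_back s₂
  obtain ⟨p, hp⟩ := leaf_nonempty s₁
  have hcl : p ∈ closure (B.back s₁) := by
    rw [mem_closure_iff_frequently]
    exact ((frequently_ahead _ p).2.and_eventually (hs₁.eventually p hp)).mono
      fun x hx => hx.2.2 hx.1
  obtain ⟨x, hx₂, hx₁⟩ := mem_closure_iff_nhds.1 hcl _ (hs₂.isOpen₂.mem_nhds (h₁₂ hp))
  refine hs₂.subset₂_of_mem hs₁.isPreconnected.2 ?_ hx₁ hx₂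
  exact (hs₁.disjoint.mono_left h₂₁).symm

/-- Non-separation is not transitive in general, so it is assumed for `l₁` and `l₃`; in a cataclysm
it is known only for distinct leaves, whence the form of `h`. -/
theorem CataclysmLT.trans {l₁ l₂ l₃ : B.LeafSpace i} (h₁₂ : B.CataclysmLT l₁ l₂)
    (h₂₃ : B.CataclysmLT l₂ l₃) (h : l₁ ≠ l₃ → NonSeparated l₁ l₃) : B.CataclysmLT l₁ l₃ := by
  have hne : l₁ ≠ l₃ := by
    rintro rfl
    exact h₁₂.asymm h₂₃
  obtain ⟨s₁, h₁⟩ := exists_crosses l₁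
  obtain ⟨s₂, h₂⟩ := exists_crosses l₂
  obtain ⟨s₃, h₃⟩ := exists_crosses l₃
  rw [cataclysmLT_iff hne (h hne) h₁ h₃]
  have e₁₂ := (cataclysmLT_iff h₁₂.1 h₁₂.2.1 h₁ h₂).1 h₁₂
  have e₂₃ := (cataclysmLT_iff h₂₃.1 h₂₃.2.1 h₂ h₃).1 h₂₃
  exact e₁₂.trans (back_subset_back e₂₃
    ((leaf_subset_back_iff_subset_front h₂₃.1 h₂₃.2.1 h₂ h₃).1 e₂₃))

theorem isStrictTotalOrder_cataclysmLT {μ : Set (B.LeafSpace i)} (hμ : IsCataclysm μ) :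
    IsStrictTotalOrder μ (fun x y : μ => B.CataclysmLT (x : B.LeafSpace i) y) where
  trichotomous x y hxy hyx := by
    by_contra hne
    have hne' : (x : B.LeafSpace i) ≠ y := fun h => hne (Subtype.ext h)
    exact (cataclysmLT_or hne' (hμ.prop x.2 y.2 hne')).elim hxy hyx
  irrefl x hx := hx.1 rfl
  trans x y z hxy hyz := hxy.trans hyz fun hne => hμ.prop x.2 z.2 hne

/-! ### Invariance under automorphisms -/

theorem mem_leaf_smul_iff (g : B.autPos) (l : B.LeafSpace i) (p : P) :
    g.1 p ∈ B.leaf (g • l) ↔ p ∈ B.leaf l := by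
  change g • B.proj i p = g • l ↔ B.proj i p = l
  exact (MulAction.injective g).eq_iff

theorem LeafLT.smul (g : B.autPos) {l m : B.LeafSpace i} (h : B.LeafLT l m) :
    B.LeafLT (g • l) (g • m) := by
  obtain ⟨γ, hγ, hor, rfl, rfl⟩ := h
  refine ⟨fun t => g • γ t, (Homeomorph.smul g).isEmbedding.comp hγ, fun t => ?_, rfl, rfl⟩
  obtain ⟨U, hU, c, hc, hcγ, hca⟩ := hor t
  refine ⟨U, hU, fun r => g.1 (c r), g.1.continuous.comp_continuousOn hc, fun s hs => ?_,
    fun s hs s' hs' hss => ((g.2 _ _ _).2).2 (hca s hs s' hs' hss)⟩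
  exact congrArg (g • ·) (hcγ s hs)

theorem apply_mem_back_smul (g : B.autPos) {l : B.LeafSpace i} {p : P} (h : p ∈ B.back l) :
    g.1 p ∈ B.back (g • l) := by
  obtain ⟨m, hm, q, hq, hp⟩ := h
  refine ⟨g • m, hm.smul g, g.1 q, (mem_leaf_smul_iff g m q).2 hq, ?_⟩
  have hmaps : MapsTo g.1 (B.leaf l)ᶜ (B.leaf (g • l))ᶜ := fun x hx hx' =>
    hx ((mem_leaf_smul_iff g l x).1 hx')
  -- `connectedComponentIn` is empty at a base point outside the set, so the membership of `p`
  -- forces this.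
  have hqc : q ∈ (B.leaf l)ᶜ := by
    by_contra hq'
    rw [connectedComponentIn_eq_empty hq'] at hp
    exact hp
  exact connectedComponentIn_mono _ hmaps.image_subset
    (ContinuousOn.mapsTo_connectedComponentIn g.1.continuous.continuousOn hqc hp)

theorem Crosses.smul (g : B.autPos) {s : B.LeafSpace (otherIdx i)} {l : B.LeafSpace i}
    (h : B.Crosses s l) : B.Crosses (g • s) (g • l) := by
  obtain ⟨x, hx, hx'⟩ := h
  exact ⟨g.1 x, (mem_leaf_smul_iff g s x).2 hx, (mem_leaf_smul_iff g l x).2 hx'⟩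

theorem _root_.NonSeparated.smul {G X : Type*} [Group G] [TopologicalSpace X] [MulAction G X]
    [ContinuousConstSMul G X] (g : G) {x y : X} (h : NonSeparated x y) :
    NonSeparated (g • x) (g • y) := by
  intro U hU V hV
  obtain ⟨z, hzU, hzV⟩ := h _ ((continuous_const_smul g).continuousAt hU) _
    ((continuous_const_smul g).continuousAt hV)
  exact ⟨g • z, hzU, hzV⟩

theorem CataclysmLT.smul (g : B.autPos) {l m : B.LeafSpace i} (h : B.CataclysmLT l m) :
    B.CataclysmLT (g • l) (g • m) := by
  obtain ⟨hne, hns, s, t, hs, ht, hst⟩ := h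
  refine ⟨fun he => hne (MulAction.injective g he), hns.smul g, g • s, g • t, hs.smul g,
    ht.smul g, fun x hx => ?_⟩
  obtain ⟨y, rfl⟩ := g.1.surjective x
  exact apply_mem_back_smul g (hst ((mem_leaf_smul_iff g s y).1 hx))

theorem cataclysmLT_smul_iff (g : B.autPos) {l m : B.LeafSpace i} :
    B.CataclysmLT (g • l) (g • m) ↔ B.CataclysmLT l m := by
  refine ⟨fun h => ?_, fun h => h.smul g⟩
  have := h.smul g⁻¹
  rwa [inv_smul_smul, inv_smul_smul] at this

end BifoliatedPlane

open BifoliatedPlane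

theorem lemma3 {P : Type*} [TopologicalSpace P] (B : BifoliatedPlane P) (i : Fin 2) :
    -- the relation is well defined: it does not depend on the choice of the transverse leaves
    (∀ l₁ l₂ : B.LeafSpace i, l₁ ≠ l₂ → NonSeparated l₁ l₂ →
      (∃ s₁ s₂ : B.LeafSpace (otherIdx i), B.Crosses s₁ l₁ ∧ B.Crosses s₂ l₂) ∧
      ∀ s₁ s₂ : B.LeafSpace (otherIdx i), B.Crosses s₁ l₁ → B.Crosses s₂ l₂ →
        (B.CataclysmLT l₁ l₂ ↔ B.leaf s₁ ⊆ B.back s₂) ∧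
        (B.CataclysmLT l₂ l₁ ↔ B.leaf s₁ ⊆ B.front s₂)) ∧
    -- it is a strict linear order on every cataclysm
    (∀ μ : Set (B.LeafSpace i), IsCataclysm μ →
      IsStrictTotalOrder μ (fun x y : μ => B.CataclysmLT (x : B.LeafSpace i) y)) ∧
    -- it is invariant
    (∀ (g : B.autPos) (l₁ l₂ : B.LeafSpace i),
      B.CataclysmLT (g • l₁) (g • l₂) ↔ B.CataclysmLT l₁ l₂) ∧
    -- hence the leaf space has orderable cataclysms, also for every subgroup
    HasOrderableCataclysms B.autPos (B.LeafSpace i) ∧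
    ∀ G : Subgroup B.autPos, HasOrderableCataclysms G (B.LeafSpace i) := by
  refine ⟨fun l₁ l₂ hne h => ⟨?_, fun s₁ s₂ h₁ h₂ =>
      ⟨cataclysmLT_iff hne h h₁ h₂, cataclysmLT_iff' hne h h₁ h₂⟩⟩,
    fun μ hμ => isStrictTotalOrder_cataclysmLT hμ, fun g l₁ l₂ => cataclysmLT_smul_iff g,
    -- One relation serves for all cataclysms, so compatibility with the action is its invariance.
    ⟨fun _ => B.CataclysmLT, fun μ hμ => isStrictTotalOrder_cataclysmLT hμ,
      fun g μ hμ x hx y hy => cataclysmLT_smul_iff g⟩,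
    fun G => ⟨fun _ => B.CataclysmLT, fun μ hμ => isStrictTotalOrder_cataclysmLT hμ,
      fun g μ hμ x hx y hy => cataclysmLT_smul_iff (g : B.autPos)⟩⟩
  obtain ⟨s₁, h₁⟩ := exists_crosses l₁
  obtain ⟨s₂, h₂⟩ := exists_crosses l₂
  exact ⟨s₁, s₂, h₁, h₂⟩
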